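/- Let $P_5=\mathbb F_2[x_1,\dots,x_5]$ with $\deg x_i=1$, regarded as a module over the mod-2 Steenrod algebra $\mathcal A$ (so $Sq^0x_i=x_i$, $Sq^1x_i=x_i^2$, $Sq^rx_i=0$ for $r\ge 2$, and the Cartan formula holds), and let $\mathcal A^+$ be the augmentation ideal of $\mathcal A$. For an $\mathcal A$-submodule $M\subseteq P_5$ let $(\mathbb F_2\otimes_{\mathcal A}M)_n$ be the subspace of $\mathbb F_2\otimes_{\mathcal A}M=M/\mathcal A^+M$ of the classes of homogeneous polynomials of degree $n$ in $M$. Let $P_5^0$ (respectively $P_5^+$) be the $\mathcal A$-submodule spanned by the monomials $x_1^{e_1}\cdots x_5^{e_5}$ with $e_1\cdots e_5=0$ (respectively $e_1\cdots e_5>0$), and put $QP_5^0=\mathbb F_2\otimes_{\mathcal A}P_5^0$, $QP_5^+=\mathbb F_2\otimes_{\mathcal A}P_5^+$. For a monomial $x=x_1^{e_1}\cdots x_5^{e_5}$ let $\sigma(x)=(e_1,\dots,e_5)$, and let the weight vector of $x$ be $\omega(x)=(\omega_1(x),\omega_2(x),\dots)$, where $\omega_i(x)$ is the number of $j$ such that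 the coefficient of $2^{i-1}$ in the binary expansion of $e_j$ is $1$; trailing zeros of weight vectors are omitted. For monomials $x,y$ of the same degree, $x<y$ means that either $\omega(x)<\omega(y)$, or $\omega(x)=\omega(y)$ and $\sigma(x)<\sigma(y)$, in the left lexicographic orders. A monomial $x$ is inadmissible if there are monomials $y_1,\dots,y_t$ ($t\ge 0$) of the same degree as $x$ with $y_j<x$ for all $j$ and $x+y_1+\dots+y_t\in\mathcal A^+P_5$; otherwise it is admissible. Let $a_1,\dots,a_{188}$ be the monomials $x_1^{e_1}x_2^{e_2}x_3^{e_3}x_4^{e_4}x_5^{e_5}$ of degree $16$ whose exponent sequences $e_1e_2e_3e_4e_5$ (each $e_i$ is a single digit) are, in this order: (1) $a_1,\dots,a_4$: $11248$, $12148$, $12418$, $12481$; (2) $a_5,\dots,a_9$: $12445$, $12454$, $12544$, $13444$, $31444$; (3) $a_{10},\dots,a_{29}$: $11266$, $11626$, $11662$, $12166$, $12526$, $12562$, $13246$, $13264$, $13426$, $13462$, $13624$, $13642$, $31246$, $31264$, $31426$, $31462$, $31624$, $31642$, $35224$, $35242$; (4) $a_{30},\dots,a_{139}$: $11167$, $11176$,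 $11617$, $11671$, $11716$, $11761$, $16117$, $16171$, $16711$, $17116$, $17161$, $17611$, $71116$, $71161$, $71611$, $11257$, $11275$, $11725$, $12157$, $12175$, $12517$, $12571$, $12715$, $12751$, $17125$, $17215$, $17251$, $71125$, $71215$, $71251$, $11347$, $11374$, $11734$, $13147$, $13174$, $13417$, $13471$, $13714$, $13741$, $17134$, $17314$, $17341$, $31147$, $31174$, $31417$, $31471$, $31714$, $31741$, $34117$, $34171$, $34711$, $37114$, $37141$, $37411$, $71134$, $71314$, $71341$, $73114$, $73141$, $73411$, $11356$, $11365$, $11635$, $13156$, $13165$, $13516$, $13561$, $13615$, $13651$, $16135$, $16315$, $16351$, $31156$, $31165$, $31516$, $31561$, $31615$, $31651$, $35116$, $35161$, $35611$, $12355$, $12535$, $13255$, $13525$, $31255$, $31525$, $35125$, $35215$, $35251$, $13345$, $13354$, $13435$, $13534$, $31345$, $31354$, $31435$, $31534$, $33145$, $33154$, $33415$, $33451$, $33514$, $33541$, $34135$, $34315$, $34351$, $35134$, $35314$, $35341$; (5) $a_{140},\dots,a_{188}$: $12337$, $12373$, $12733$, $13237$, $13273$, $13327$, $13372$, $13723$,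 $13732$, $17233$, $17323$, $17332$, $31237$, $31273$, $31327$, $31372$, $31723$, $31732$, $33127$, $33172$, $33712$, $37123$, $37132$, $37312$, $71233$, $71323$, $71332$, $73123$, $73132$, $73312$, $13336$, $13363$, $13633$, $16333$, $31336$, $31363$, $31633$, $33136$, $33163$, $33316$, $33352$, $33523$, $33532$, $35233$, $35323$, $35332$, $33334$, $33343$, $33433$. Then the following hold. (i) There are exactly $443$ admissible monomials of degree $16$ in $P_5$, and $\dim_{\mathbb F_2}(\mathbb F_2\otimes_{\mathcal A}P_5)_{16}=443$. (ii) $\dim_{\mathbb F_2}(QP_5^0)_{16}=255$ and $\dim_{\mathbb F_2}(QP_5^+)_{16}=188$, and the classes of $a_1,\dots,a_{188}$ form a basis of $(QP_5^+)_{16}$. (iii) The set of the admissible monomials of degree $16$ that lie in $P_5^+$ is $\{a_1,\dots,a_{188}\}$. Among them, those of weight vector $(2,1,1,1)$, $(2,1,3)$, $(2,3,2)$, $(4,2,2)$ and $(4,4,1)$ are, respectively, the monomials listed in (1), (2), (3), (4) and (5); their numbers are $4$, $5$, $20$, $110$ and $49$. -/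

import Mathlib

open MvPolynomial

noncomputable section

namespace HitProblem

/-- The polynomial algebra `P_k = 𝔽₂[x₁, …, x_k]`, with every `x_i` in degree `1`
(the variable `x_i` of the text is `X (i - 1)`). -/
abbrev P (k : ℕ) : Type := MvPolynomial (Fin k) (ZMod 2)

/-- The total Steenrod square `f ↦ ∑ᵢ Sqⁱ(f) Tⁱ`.  By the Cartan formula it is a homomorphism of
algebras, and `Sq⁰ x = x`, `Sq¹ x = x²`, `Sqⁱ x = 0` for `i ≥ 2` when `x` has degree `1`. -/
def totalSq (k : ℕ) : P k →ₐ[ZMod 2] Polynomial (P k) :=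
  aeval fun j => Polynomial.C (X j) + Polynomial.C (X j ^ 2) * Polynomial.X

/-- The Steenrod square `Sqⁱ : P_k → P_k`. -/
def Sq (i k : ℕ) : P k →ₗ[ZMod 2] P k :=
  ((Polynomial.lcoeff (P k) i).restrictScalars (ZMod 2)).comp (totalSq k).toLinearMap

/-- The augmentation ideal `𝒜⁺` (the elements of positive degree) of the mod-2 Steenrod algebra,
that is, the non-unital algebra generated by the `Sqⁱ` with `i ≥ 1`.  The Steenrod algebra is
realized faithfully by its simultaneous action on all the polynomial algebras `P_n`; an operation
`θ` acts on `P_k` as `θ k`. -/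
def APlus : NonUnitalSubalgebra (ZMod 2) (∀ n : ℕ, Module.End (ZMod 2) (P n)) :=
  NonUnitalAlgebra.adjoin (ZMod 2) {θ | ∃ i : ℕ, 1 ≤ i ∧ θ = fun n => Sq i n}

/-- `𝒜⁺M`, for a subspace `M` of `P_k` that is stable under the Steenrod algebra; the elements of
`𝒜⁺P_k` are the hit polynomials. -/
def hit {k : ℕ} (M : Submodule (ZMod 2) (P k)) : Submodule (ZMod 2) (P k) :=
  Submodule.span (ZMod 2) {g | ∃ θ ∈ APlus, ∃ f ∈ M, g = θ k f}

/-- The degree-`n` part `(𝔽₂ ⊗_𝒜 M)_n` of `𝔽₂ ⊗_𝒜 M = M / 𝒜⁺M`: the classes of the homogeneous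
polynomials of degree `n` in `M`.  As `𝒜⁺M ⊆ M ⊆ P_k`, the space `M / 𝒜⁺M` is regarded as a
subspace of `P_k / 𝒜⁺M`. -/
def Q {k : ℕ} (M : Submodule (ZMod 2) (P k)) (n : ℕ) : Submodule (ZMod 2) (P k ⧸ hit M) :=
  (M ⊓ homogeneousSubmodule (Fin k) (ZMod 2) n).map (hit M).mkQ

/-- The monomial `x₁^{a₁} ⋯ x_k^{a_k}`; monomials are given by their exponent vectors. -/
def mono {k : ℕ} (a : Fin k →₀ ℕ) : P k := monomial a 1

/-- `P_k⁰`, spanned by the monomials in which some variable does not occur. -/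
def PZero (k : ℕ) : Submodule (ZMod 2) (P k) :=
  Submodule.span (ZMod 2) {f | ∃ a : Fin k →₀ ℕ, ∏ j, a j = 0 ∧ f = mono a}

/-- `P_k⁺`, spanned by the monomials in which every variable occurs. -/
def PPlus (k : ℕ) : Submodule (ZMod 2) (P k) :=
  Submodule.span (ZMod 2) {f | ∃ a : Fin k →₀ ℕ, 0 < ∏ j, a j ∧ f = mono a}

/-- The weight vector `ω(x) = (ω₁(x), ω₂(x), …)`: `weight a i` is `ω_{i+1}`, the number of exponents
with the binary digit `1` in the place of `2^i`. -/
def weight {k : ℕ} (a : Fin k →₀ ℕ) : ℕ → ℕ := fun i => ∑ j, a j / 2 ^ i % 2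

/-- The order on monomials of the same degree: first compare the weight vectors, then the exponent
vectors, both in the left lexicographic order. -/
def MonoLT {k : ℕ} (a b : Fin k →₀ ℕ) : Prop :=
  toLex (weight a) < toLex (weight b) ∨
    weight a = weight b ∧ toLex (a : Fin k → ℕ) < toLex (b : Fin k → ℕ)

/-- A monomial `x` is inadmissible if `x + y₁ + ⋯ + y_t ∈ 𝒜⁺P_k` for some monomials `y_j < x` of the
same degree as `x`. -/
def Inadmissible {k : ℕ} (a : Fin k →₀ ℕ) : Prop :=
  ∃ (t : ℕ) (b : Fin t → Fin k →₀ ℕ), (∀ j, (b j).degree = a.degree ∧ MonoLT (b j) a) ∧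
    mono a + ∑ j, mono (b j) ∈ hit (⊤ : Submodule (ZMod 2) (P k))

/-- `B_k(n)`: the admissible monomials of degree `n` in `P_k`. -/
def B (k n : ℕ) : Set (Fin k →₀ ℕ) := {a | a.degree = n ∧ ¬ Inadmissible a}

/-- `B_k⁺(n) = B_k(n) ∩ P_k⁺`. -/
def BPlus (k n : ℕ) : Set (Fin k →₀ ℕ) := {a | a ∈ B k n ∧ mono a ∈ PPlus k}

/-- The weight vector `(ω₁, ω₂, …, ω_s, 0, 0, …)`. -/
def weightVec (l : List ℕ) : ℕ → ℕ := fun i => l.getD i 0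

/-- The admissible monomials of degree `n` in `P_k⁺` of weight vector exactly `ω`. -/
def BPlusWeight (k n : ℕ) (ω : List ℕ) : Set (Fin k →₀ ℕ) :=
  {a | a ∈ BPlus k n ∧ weight a = weightVec ω}

/-- The exponent vectors of the monomials `a_{16,1}, …, a_{16,188}`, in this order. -/
def aList : List (Fin 5 → ℕ) :=
  [![1, 1, 2, 4, 8], ![1, 2, 1, 4, 8], ![1, 2, 4, 1, 8], ![1, 2, 4, 8, 1], ![1, 2, 4, 4, 5],
   ![1, 2, 4, 5, 4], ![1, 2, 5, 4, 4], ![1, 3, 4, 4, 4], ![3, 1, 4, 4, 4], ![1, 1, 2, 6, 6],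
   ![1, 1, 6, 2, 6], ![1, 1, 6, 6, 2], ![1, 2, 1, 6, 6], ![1, 2, 5, 2, 6], ![1, 2, 5, 6, 2],
   ![1, 3, 2, 4, 6], ![1, 3, 2, 6, 4], ![1, 3, 4, 2, 6], ![1, 3, 4, 6, 2], ![1, 3, 6, 2, 4],
   ![1, 3, 6, 4, 2], ![3, 1, 2, 4, 6], ![3, 1, 2, 6, 4], ![3, 1, 4, 2, 6], ![3, 1, 4, 6, 2],
   ![3, 1, 6, 2, 4], ![3, 1, 6, 4, 2], ![3, 5, 2, 2, 4], ![3, 5, 2, 4, 2], ![1, 1, 1, 6, 7],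
   ![1, 1, 1, 7, 6], ![1, 1, 6, 1, 7], ![1, 1, 6, 7, 1], ![1, 1, 7, 1, 6], ![1, 1, 7, 6, 1],
   ![1, 6, 1, 1, 7], ![1, 6, 1, 7, 1], ![1, 6, 7, 1, 1], ![1, 7, 1, 1, 6], ![1, 7, 1, 6, 1],
   ![1, 7, 6, 1, 1], ![7, 1, 1, 1, 6], ![7, 1, 1, 6, 1], ![7, 1, 6, 1, 1], ![1, 1, 2, 5, 7],
   ![1, 1, 2, 7, 5], ![1, 1, 7, 2, 5], ![1, 2, 1, 5, 7], ![1, 2, 1, 7, 5], ![1, 2, 5, 1, 7],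
   ![1, 2, 5, 7, 1], ![1, 2, 7, 1, 5], ![1, 2, 7, 5, 1], ![1, 7, 1, 2, 5], ![1, 7, 2, 1, 5],
   ![1, 7, 2, 5, 1], ![7, 1, 1, 2, 5], ![7, 1, 2, 1, 5], ![7, 1, 2, 5, 1], ![1, 1, 3, 4, 7],
   ![1, 1, 3, 7, 4], ![1, 1, 7, 3, 4], ![1, 3, 1, 4, 7], ![1, 3, 1, 7, 4], ![1, 3, 4, 1, 7],
   ![1, 3, 4, 7, 1], ![1, 3, 7, 1, 4], ![1, 3, 7, 4, 1], ![1, 7, 1, 3, 4], ![1, 7, 3, 1, 4],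
   ![1, 7, 3, 4, 1], ![3, 1, 1, 4, 7], ![3, 1, 1, 7, 4], ![3, 1, 4, 1, 7], ![3, 1, 4, 7, 1],
   ![3, 1, 7, 1, 4], ![3, 1, 7, 4, 1], ![3, 4, 1, 1, 7], ![3, 4, 1, 7, 1], ![3, 4, 7, 1, 1],
   ![3, 7, 1, 1, 4], ![3, 7, 1, 4, 1], ![3, 7, 4, 1, 1], ![7, 1, 1, 3, 4], ![7, 1, 3, 1, 4],
   ![7, 1, 3, 4, 1], ![7, 3, 1, 1, 4], ![7, 3, 1, 4, 1], ![7, 3, 4, 1, 1], ![1, 1, 3, 5, 6],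
   ![1, 1, 3, 6, 5], ![1, 1, 6, 3, 5], ![1, 3, 1, 5, 6], ![1, 3, 1, 6, 5], ![1, 3, 5, 1, 6],
   ![1, 3, 5, 6, 1], ![1, 3, 6, 1, 5], ![1, 3, 6, 5, 1], ![1, 6, 1, 3, 5], ![1, 6, 3, 1, 5],
   ![1, 6, 3, 5, 1], ![3, 1, 1, 5, 6], ![3, 1, 1, 6, 5], ![3, 1, 5, 1, 6], ![3, 1, 5, 6, 1],
   ![3, 1, 6, 1, 5], ![3, 1, 6, 5, 1], ![3, 5, 1, 1, 6], ![3, 5, 1, 6, 1], ![3, 5, 6, 1, 1],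
   ![1, 2, 3, 5, 5], ![1, 2, 5, 3, 5], ![1, 3, 2, 5, 5], ![1, 3, 5, 2, 5], ![3, 1, 2, 5, 5],
   ![3, 1, 5, 2, 5], ![3, 5, 1, 2, 5], ![3, 5, 2, 1, 5], ![3, 5, 2, 5, 1], ![1, 3, 3, 4, 5],
   ![1, 3, 3, 5, 4], ![1, 3, 4, 3, 5], ![1, 3, 5, 3, 4], ![3, 1, 3, 4, 5], ![3, 1, 3, 5, 4],
   ![3, 1, 4, 3, 5], ![3, 1, 5, 3, 4], ![3, 3, 1, 4, 5], ![3, 3, 1, 5, 4], ![3, 3, 4, 1, 5],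
   ![3, 3, 4, 5, 1], ![3, 3, 5, 1, 4], ![3, 3, 5, 4, 1], ![3, 4, 1, 3, 5], ![3, 4, 3, 1, 5],
   ![3, 4, 3, 5, 1], ![3, 5, 1, 3, 4], ![3, 5, 3, 1, 4], ![3, 5, 3, 4, 1], ![1, 2, 3, 3, 7],
   ![1, 2, 3, 7, 3], ![1, 2, 7, 3, 3], ![1, 3, 2, 3, 7], ![1, 3, 2, 7, 3], ![1, 3, 3, 2, 7],
   ![1, 3, 3, 7, 2], ![1, 3, 7, 2, 3], ![1, 3, 7, 3, 2], ![1, 7, 2, 3, 3], ![1, 7, 3, 2, 3],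
   ![1, 7, 3, 3, 2], ![3, 1, 2, 3, 7], ![3, 1, 2, 7, 3], ![3, 1, 3, 2, 7], ![3, 1, 3, 7, 2],
   ![3, 1, 7, 2, 3], ![3, 1, 7, 3, 2], ![3, 3, 1, 2, 7], ![3, 3, 1, 7, 2], ![3, 3, 7, 1, 2],
   ![3, 7, 1, 2, 3], ![3, 7, 1, 3, 2], ![3, 7, 3, 1, 2], ![7, 1, 2, 3, 3], ![7, 1, 3, 2, 3],
   ![7, 1, 3, 3, 2], ![7, 3, 1, 2, 3], ![7, 3, 1, 3, 2], ![7, 3, 3, 1, 2], ![1, 3, 3, 3, 6],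
   ![1, 3, 3, 6, 3], ![1, 3, 6, 3, 3], ![1, 6, 3, 3, 3], ![3, 1, 3, 3, 6], ![3, 1, 3, 6, 3],
   ![3, 1, 6, 3, 3], ![3, 3, 1, 3, 6], ![3, 3, 1, 6, 3], ![3, 3, 3, 1, 6], ![3, 3, 3, 5, 2],
   ![3, 3, 5, 2, 3], ![3, 3, 5, 3, 2], ![3, 5, 2, 3, 3], ![3, 5, 3, 2, 3], ![3, 5, 3, 3, 2],
   ![3, 3, 3, 3, 4], ![3, 3, 3, 4, 3], ![3, 3, 4, 3, 3]]

/-- The exponent vector of the monomial `a_{16,t}`, for `1 ≤ t ≤ 188`. -/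
def a (t : ℕ) : Fin 5 →₀ ℕ := Finsupp.equivFunOnFinite.symm (aList.getD (t - 1) 0)

/-- The class of `a_{16,t}` in `QP₅⁺ = 𝔽₂ ⊗_𝒜 P₅⁺`. -/
def aClass (t : ℕ) : P 5 ⧸ hit (PPlus 5) := (hit (PPlus 5)).mkQ (mono (a t))

end HitProblem

end

noncomputable section

namespace HitProblem

def basisCodes1 : List ℕ :=
  []

def relationCodes1 : List (List ℕ) :=
  [[0x1f]]

def basisCodes2 : List ℕ :=
  [0x1f, 0x3d, 0xf1]

def relationCodes2 : List (List ℕ) :=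
  [[0x1d2], [0x1b4], [0x196], [0x178], [0x15a], [0x13c], [0x11e], [0x23b], [0x457], [0x277],
   [0x475], [0x2b3]]

def basisCodes3 : List ℕ :=
  [0x11e, 0x12d, 0x13c, 0x1e1, 0x31c]

def relationCodes3 : List (List ℕ) :=
  [[0x1b22], [0x1942], [0x1924], [0x1762], [0x1744], [0x1726], [0x1582], [0x1564], [0x1546],
   [0x1528], [0x13a2], [0x1384], [0x1366], [0x1348], [0x132a], [0x11c2], [0x11a4], [0x1186],
   [0x1168], [0x114a], [0x112c], [0x231a], [0x213a], [0x212b], [0x113b], [0x111d], [0x221b],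
   [0x4147], [0x4156], [0x4417], [0x4516], [0x2716], [0x2617], [0x2176], [0x2167], [0x1717],
   [0x1519], [0x131b], [0x1177], [0x1159], [0x2239], [0x2257], [0x2329], [0x4327], [0x4165],
   [0x4174], [0x4255], [0x4345], [0x4435], [0x4525], [0x4615], [0x4714], [0x2b12], [0x2a13],
   [0x2923], [0x2833], [0x2743], [0x2653], [0x2383], [0x2365], [0x2293], [0x2275], [0x21b2],
   [0x21a3], [0x1b13], [0x1735], [0x1555], [0x1375], [0x1339], [0x11d1], [0x11b3], [0x22b1],
   [0x2356], [0x2536], [0x4354], [0x4363], [0x4471], [0x4534], [0x4633], [0x2932], [0x2752],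
   [0x2671], [0x2392], [0x2374], [0x1753], [0x1591], [0x1573], [0x1537], [0x1357], [0x23a1],
   [0x4372], [0x4561], [0x4651], [0x4732], [0x2a31], [0x2761], [0x1b31], [0x1771], [0x2b21],
   [0x1d11]]

def basisCodes4 : List ℕ :=
  [0x112c, 0x121c, 0x1249, 0x1258, 0x12c1, 0x1348, 0x3148, 0x1366, 0x3166, 0x3526, 0x3562, 0x1177,
   0x1357, 0x1375, 0x1717, 0x1735, 0x1771, 0x3157, 0x3175, 0x3355, 0x3517, 0x3535, 0x3571, 0x3715,
   0x3751, 0x7117, 0x7135, 0x7171, 0x7315, 0x7351, 0x7711, 0x3337, 0x3373, 0x3733, 0x7333]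

def relationCodes4 : List (List ℕ) :=
  [[0x19222], [0x17422], [0x17242], [0x17224], [0x15622], [0x15442], [0x15424], [0x15262],
   [0x15244], [0x15226], [0x13822], [0x13642], [0x13624], [0x13462], [0x13444], [0x13426],
   [0x13282], [0x13264], [0x13246], [0x13228], [0x11a22], [0x11842], [0x11824], [0x11662],
   [0x11644], [0x11626], [0x11482], [0x11464], [0x11446], [0x11428], [0x112a2], [0x11284],
   [0x11266], [0x11248], [0x1122a], [0x43144], [0x41344], [0x41254], [0x41245], [0x23182],
   [0x23164], [0x23146], [0x23128], [0x21382], [0x21364], [0x21346], [0x21328], [0x212a1],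
   [0x21292], [0x21283], [0x21274], [0x21265], [0x21256], [0x21247], [0x21238], [0x21229],
   [0x2121a], [0x2112a], [0x11491], [0x11473], [0x11455], [0x11437], [0x11419], [0x11383],
   [0x11374], [0x11365], [0x11356], [0x11347], [0x11338], [0x11149], [0x1111c], [0x21355],
   [0x2211a], [0x22129], [0x22147], [0x22219], [0x22255], [0x22291], [0x22417], [0x22435],
   [0x22453], [0x22471], [0x41146], [0x41227], [0x41236], [0x41263], [0x41272], [0x41326],
   [0x41362], [0x41416], [0x41425], [0x41434], [0x41443], [0x41452], [0x41461], [0x41524],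
   [0x41542], [0x42127], [0x42145], [0x42217], [0x42235], [0x42253], [0x42271], [0x42415],
   [0x42433], [0x42451], [0x43126], [0x43162], [0x44116], [0x44125], [0x44215], [0x44233],
   [0x44251], [0x45124], [0x45142], [0x28231], [0x28213], [0x28123], [0x27124], [0x26431],
   [0x26413], [0x26143], [0x26116], [0x22831], [0x22813], [0x22651], [0x22615], [0x22183],
   [0x22165], [0x21724], [0x21661], [0x21634], [0x21625], [0x21616], [0x21166], [0x2111b],
   [0x18133], [0x17143], [0x17134], [0x15145], [0x15118], [0x14155], [0x13183], [0x13165],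
   [0x13156], [0x13147], [0x13129], [0x1311a], [0x1113a], [0x11743], [0x11734], [0x11581],
   [0x11554], [0x11545], [0x11518], [0x113a1], [0x11392], [0x11329], [0x1131a], [0x11158],
   [0x21139], [0x21319], [0x21391], [0x44134], [0x22318], [0x22345], [0x22354], [0x22381],
   [0x22516], [0x22525], [0x22534], [0x22543], [0x22552], [0x22561], [0x23119], [0x23155],
   [0x23218], [0x23245], [0x43216], [0x43225], [0x43243], [0x26134], [0x26152], [0x41155],
   [0x41164], [0x41515], [0x41551], [0x41614], [0x41623], [0x41632], [0x41641], [0x41722],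
   [0x42154], [0x42163], [0x42514], [0x42523], [0x42532], [0x42541], [0x42613], [0x42631],
   [0x43414], [0x43423], [0x44152], [0x44314], [0x44323], [0x44332], [0x44341], [0x45115],
   [0x45214], [0x45223], [0x46114], [0x46123], [0x46132], [0x46213], [0x46231], [0x47122],
   [0x2a112], [0x29212], [0x28321], [0x28312], [0x27412], [0x26521], [0x26512], [0x22174],
   [0x23812], [0x23614], [0x22921], [0x22912], [0x22741], [0x22714], [0x21a21], [0x21a12],
   [0x211a2], [0x1b112], [0x1a131], [0x19141], [0x19132], [0x18511], [0x18151], [0x17413],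
   [0x17323], [0x15514], [0x15154], [0x14911], [0x14731], [0x14713], [0x14533], [0x14371],
   [0x14353], [0x14335], [0x14317], [0x14191], [0x14173], [0x14137], [0x13723], [0x13561],
   [0x13552], [0x13525], [0x13516], [0x13435], [0x13417], [0x13345], [0x13327], [0x13273],
   [0x13237], [0x131a1], [0x13192], [0x11c11], [0x11b21], [0x11b12], [0x111c1], [0x111b2],
   [0x211b1], [0x21b11], [0x22237], [0x22273], [0x22327], [0x22336], [0x22363], [0x22372],
   [0x22723], [0x22732], [0x23191], [0x23227], [0x23236], [0x23254], [0x23326], [0x23335],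
   [0x43234], [0x43252], [0x23515], [0x23524], [0x23542], [0x23551], [0x25324], [0x46141],
   [0x26611], [0x27223], [0x27241], [0x27421], [0x29131], [0x2a121], [0x43342], [0x43432],
   [0x43522], [0x43612], [0x45241], [0x45322], [0x45421], [0x46312], [0x46321], [0x46411],
   [0x47221], [0x1b211], [0x29311], [0x15541], [0x15451], [0x13831], [0x13381], [0x17431],
   [0x17341], [0x17215], [0x17125], [0x15433], [0x15343], [0x15334], [0x15325], [0x15316],
   [0x15235], [0x15217], [0x15136], [0x15127], [0x13921], [0x13741], [0x13543], [0x13534],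
   [0x13471], [0x13453], [0x13363], [0x12751], [0x12715], [0x12571], [0x12553], [0x12535],
   [0x12517], [0x12175], [0x12157], [0x11752], [0x11725], [0x11572], [0x11563], [0x11536],
   [0x11527], [0x11275], [0x11257], [0x23263], [0x23272], [0x23362], [0x23623], [0x23632],
   [0x23722], [0x45511], [0x26233], [0x26323], [0x27232], [0x27322], [0x2b111], [0x41137],
   [0x41173], [0x41317], [0x41335], [0x41353], [0x41371], [0x41533], [0x41713], [0x41731],
   [0x43117], [0x43135], [0x43315], [0x47113], [0x15613], [0x15163], [0x23317], [0x23137],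
   [0x21733], [0x21373], [0x21337], [0x17521], [0x17512], [0x17251], [0x17152], [0x15721],
   [0x15712], [0x15631], [0x15532], [0x15361], [0x15352], [0x15271], [0x15172], [0x43153],
   [0x43171], [0x43351], [0x43513], [0x43531], [0x43711], [0x45133], [0x45313], [0x45331],
   [0x47131], [0x47311], [0x27331], [0x27313], [0x27133], [0x23731], [0x23713], [0x23371],
   [0x23173], [0x23353, 0x43333], [0x25333], [0x23533]]

def basisCodes5 : List ℕ :=
  [0x11248, 0x12148, 0x12418, 0x12481, 0x12445, 0x12454, 0x12544, 0x13444, 0x31444, 0x11266,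
   0x11626, 0x11662, 0x12166, 0x12526, 0x12562, 0x13246, 0x13264, 0x13426, 0x13462, 0x13624,
   0x13642, 0x31246, 0x31264, 0x31426, 0x31462, 0x31624, 0x31642, 0x35224, 0x35242, 0x11167,
   0x11176, 0x11257, 0x11275, 0x11347, 0x11356, 0x11365, 0x11374, 0x11617, 0x11635, 0x11671,
   0x11716, 0x11725, 0x11734, 0x11761, 0x12157, 0x12175, 0x12355, 0x12517, 0x12535, 0x12571,
   0x12715, 0x12751, 0x13147, 0x13156, 0x13165, 0x13174, 0x13255, 0x13345, 0x13354, 0x13417,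
   0x13435, 0x13471, 0x13516, 0x13525, 0x13534, 0x13561, 0x13615, 0x13651, 0x13714, 0x13741,
   0x16117, 0x16135, 0x16171, 0x16315, 0x16351, 0x16711, 0x17116, 0x17125, 0x17134, 0x17161,
   0x17215, 0x17251, 0x17314, 0x17341, 0x17611, 0x31147, 0x31156, 0x31165, 0x31174, 0x31255,
   0x31345, 0x31354, 0x31417, 0x31435, 0x31471, 0x31516, 0x31525, 0x31534, 0x31561, 0x31615,
   0x31651, 0x31714, 0x31741, 0x33145, 0x33154, 0x33415, 0x33451, 0x33514, 0x33541, 0x34117,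
   0x34135, 0x34171, 0x34315, 0x34351, 0x34711, 0x35116, 0x35125, 0x35134, 0x35161, 0x35215,
   0x35251, 0x35314, 0x35341, 0x35611, 0x37114, 0x37141, 0x37411, 0x71116, 0x71125, 0x71134,
   0x71161, 0x71215, 0x71251, 0x71314, 0x71341, 0x71611, 0x73114, 0x73141, 0x73411, 0x12337,
   0x12373, 0x12733, 0x13237, 0x13273, 0x13327, 0x13336, 0x13363, 0x13372, 0x13633, 0x13723,
   0x13732, 0x16333, 0x17233, 0x17323, 0x17332, 0x31237, 0x31273, 0x31327, 0x31336, 0x31363,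
   0x31372, 0x31633, 0x31723, 0x31732, 0x33127, 0x33136, 0x33163, 0x33172, 0x33316, 0x33334,
   0x33343, 0x33352, 0x33433, 0x33523, 0x33532, 0x33712, 0x35233, 0x35323, 0x35332, 0x37123,
   0x37132, 0x37312, 0x71233, 0x71323, 0x71332, 0x73123, 0x73132, 0x73312]

def relationCodes5 : List (List ℕ) :=
  [[0x172222], [0x154222], [0x152422], [0x152242], [0x152224], [0x136222], [0x134422], [0x134242],
   [0x134224], [0x132622], [0x132442], [0x132424], [0x132262], [0x132244], [0x132226], [0x118222],
   [0x116422], [0x116242], [0x116224], [0x114622], [0x114442], [0x114424], [0x114262], [0x114244],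
   [0x114226], [0x112822], [0x112642], [0x112624], [0x112462], [0x112444], [0x112426], [0x112282],
   [0x112264], [0x112246], [0x112228], [0x412441], [0x412414], [0x412144], [0x411244], [0x231442],
   [0x231424], [0x231244], [0x213442], [0x213424], [0x213244], [0x212821], [0x212812], [0x212641],
   [0x212614], [0x212542], [0x212524], [0x212461], [0x212452], [0x212443], [0x212434], [0x212425],
   [0x212416], [0x212344], [0x212281], [0x212254], [0x212245], [0x212218], [0x212182], [0x212164],
   [0x212146], [0x212128], [0x211282], [0x211264], [0x211246], [0x211228], [0x114811], [0x114541],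
   [0x114514], [0x114451], [0x114433], [0x114415], [0x114343], [0x114334], [0x114181], [0x114154],
   [0x114145], [0x114118], [0x113641], [0x113614], [0x113542], [0x113524], [0x113461], [0x113452],
   [0x113443], [0x113434], [0x113425], [0x113416], [0x113344], [0x113254], [0x113245], [0x113164],
   [0x113146], [0x111562], [0x111526], [0x111481], [0x111454], [0x111445], [0x111418], [0x111184],
   [0x111166], [0x111148], [0x213145], [0x213154], [0x213334], [0x213415], [0x213451], [0x213514],
   [0x213541], [0x221128], [0x221146], [0x221164], [0x221182], [0x221218], [0x221245], [0x221254],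
   [0x221281], [0x221416], [0x221425], [0x221434], [0x221443], [0x221452], [0x221461], [0x222118],
   [0x222145], [0x222154], [0x222181], [0x222415], [0x222451], [0x222514], [0x222541], [0x222811],
   [0x224116], [0x224125], [0x224134], [0x224143], [0x224152], [0x224161], [0x224215], [0x224251],
   [0x224314], [0x224341], [0x224413], [0x224431], [0x224512], [0x224521], [0x224611], [0x411226],
   [0x411262], [0x411424], [0x411442], [0x412126], [0x412162], [0x412216], [0x412225], [0x412234],
   [0x412243], [0x412252], [0x412261], [0x412324], [0x412342], [0x412423], [0x412432], [0x412522],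
   [0x412612], [0x412621], [0x413224], [0x413242], [0x413422], [0x414124], [0x414142], [0x414214],
   [0x414223], [0x414232], [0x414241], [0x414322], [0x414412], [0x414421], [0x415222], [0x421126],
   [0x421162], [0x421216], [0x421225], [0x421234], [0x421243], [0x421252], [0x421261], [0x421414],
   [0x421423], [0x421432], [0x421441], [0x422116], [0x422125], [0x422134], [0x422143], [0x422152],
   [0x422161], [0x422215], [0x422251], [0x422314], [0x422341], [0x422413], [0x422431], [0x422512],
   [0x422521], [0x422611], [0x424114], [0x424123], [0x424132], [0x424141], [0x424213], [0x424231],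
   [0x424312], [0x424321], [0x424411], [0x431224], [0x431242], [0x431422], [0x441124], [0x441142],
   [0x441214], [0x441223], [0x441232], [0x441241], [0x442114], [0x442123], [0x442132], [0x442141],
   [0x442213], [0x442231], [0x442312], [0x442321], [0x442411], [0x451222], [0x282211], [0x282121],
   [0x282112], [0x281221], [0x281212], [0x281131], [0x281113], [0x264211], [0x264121], [0x264112],
   [0x261421], [0x261412], [0x261124], [0x231622], [0x231262], [0x231226], [0x228211], [0x228121],
   [0x228112], [0x226411], [0x226141], [0x226114], [0x221821], [0x221812], [0x221641], [0x221614],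
   [0x221191], [0x221119], [0x218311], [0x218131], [0x218113], [0x216241], [0x216214], [0x216124],
   [0x213622], [0x213262], [0x213226], [0x212911], [0x212191], [0x212119], [0x211831], [0x211813],
   [0x211624], [0x211291], [0x211219], [0x2111a1], [0x211192], [0x211183], [0x211138], [0x211129],
   [0x21111a], [0x181321], [0x171115], [0x151441], [0x151414], [0x151144], [0x144331], [0x144313],
   [0x144133], [0x141541], [0x141514], [0x141433], [0x131821], [0x131812], [0x131641], [0x131614],
   [0x131542], [0x131524], [0x131461], [0x131452], [0x131443], [0x131434], [0x131425], [0x131416],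
   [0x131281], [0x131254], [0x131245], [0x131218], [0x131182], [0x131164], [0x131146], [0x131128],
   [0x111382], [0x111328], [0x117115], [0x115441], [0x115414], [0x115144], [0x113821], [0x113812],
   [0x113281], [0x113218], [0x113182], [0x113128], [0x111715], [0x111544], [0x111175], [0x111157],
   [0x211318], [0x211381], [0x213118], [0x213181], [0x213811], [0x441322], [0x223144], [0x223414],
   [0x223441], [0x225124], [0x225142], [0x225214], [0x225241], [0x225412], [0x225421], [0x231118],
   [0x231145], [0x231154], [0x231181], [0x231415], [0x231451], [0x231514], [0x231541], [0x231811],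
   [0x232144], [0x232414], [0x232441], [0x432124], [0x432142], [0x432214], [0x432241], [0x432412],
   [0x432421], [0x281311], [0x411514], [0x411541], [0x411622], [0x415114], [0x415141], [0x415411],
   [0x416122], [0x416212], [0x416221], [0x421522], [0x421612], [0x421621], [0x425122], [0x425212],
   [0x425221], [0x426112], [0x426121], [0x426211], [0x434122], [0x434212], [0x434221], [0x441511],
   [0x443122], [0x443212], [0x443221], [0x451114], [0x451141], [0x451411], [0x452122], [0x452212],
   [0x452221], [0x461122], [0x461212], [0x461221], [0x462112], [0x462121], [0x462211], [0x2a1111],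
   [0x292111], [0x283111], [0x238111], [0x229111], [0x21a111], [0x211a11], [0x143431], [0x143413],
   [0x143341], [0x143323], [0x143143], [0x143134], [0x141343], [0x141334], [0x135241], [0x135214],
   [0x135142], [0x135124], [0x134431], [0x134413], [0x134341], [0x134323], [0x134143], [0x134134],
   [0x133441], [0x133423], [0x133243], [0x132343], [0x223234], [0x223243], [0x223324], [0x223342],
   [0x223423], [0x223432], [0x231334], [0x232234], [0x232243], [0x232324], [0x232342], [0x232423],
   [0x232432], [0x233134], [0x233224], [0x233242], [0x233314], [0x233332], [0x233341], [0x235114],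
   [0x235141], [0x236122], [0x153241], [0x153214], [0x153142], [0x153124], [0x152431], [0x152413],
   [0x152341], [0x152332], [0x152323], [0x152314], [0x152233], [0x152143], [0x152134], [0x151432],
   [0x151423], [0x151342], [0x151324], [0x151243], [0x151234], [0x125431], [0x125413], [0x125341],
   [0x125332], [0x125323], [0x125314], [0x125233], [0x125143], [0x125134], [0x115432], [0x115423],
   [0x115342], [0x115324], [0x115243], [0x115234], [0x216223], [0x216232], [0x216322], [0x261223],
   [0x261232], [0x261322], [0x263122], [0x413134], [0x413143], [0x413314], [0x413341], [0x413413],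
   [0x413431], [0x431134], [0x431143], [0x431314], [0x431341], [0x431413], [0x431431], [0x433114],
   [0x433141], [0x155122], [0x151522], [0x151252], [0x151225], [0x115522], [0x115252], [0x115225],
   [0x223225], [0x223252], [0x223522], [0x225223], [0x225232], [0x225322], [0x232225], [0x232252],
   [0x232522], [0x432223], [0x432232], [0x432322], [0x235222], [0x253222], [0x154321], [0x154312],
   [0x154231], [0x154213], [0x154132], [0x154123], [0x153421], [0x153412], [0x153322], [0x153232],
   [0x153223], [0x145321], [0x145312], [0x145231], [0x145213], [0x145132], [0x145123], [0x143521],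
   [0x143512], [0x143251], [0x143215], [0x143161], [0x143125], [0x136231], [0x136213], [0x135421],
   [0x135412], [0x135322], [0x134521], [0x134512], [0x134251], [0x134215], [0x134161], [0x134125],
   [0x133621], [0x133261], [0x133225], [0x223126], [0x223162], [0x223216], [0x223261], [0x223612],
   [0x223621], [0x226123], [0x226132], [0x226213], [0x226231], [0x226312], [0x226321], [0x232126],
   [0x232162], [0x232216], [0x232261], [0x232612], [0x232621], [0x233116], [0x233125], [0x233161],
   [0x233215], [0x233251], [0x254113], [0x254131], [0x254311], [0x253411], [0x236212], [0x236221],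
   [0x245113], [0x245131], [0x245311], [0x262123], [0x262132], [0x262213], [0x262231], [0x262312],
   [0x262321], [0x263212], [0x263221], [0x433411], [0x434113], [0x434131], [0x434311], [0x443113],
   [0x443131], [0x443311], [0x156211], [0x156121], [0x156112], [0x152611], [0x152161], [0x152116],
   [0x151621], [0x151612], [0x151261], [0x151216], [0x151162], [0x151126], [0x233611], [0x125611],
   [0x125161], [0x125116], [0x115621], [0x115612], [0x115261], [0x115216], [0x115162], [0x115126],
   [0x153115], [0x135115], [0x236113], [0x263113], [0x413116], [0x413125], [0x413152], [0x413161],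
   [0x413215], [0x413251], [0x413512], [0x413521], [0x413611], [0x415123], [0x415132], [0x415213],
   [0x415231], [0x415312], [0x415321], [0x416113], [0x416131], [0x416311], [0x423115], [0x423151],
   [0x423511], [0x425113], [0x425131], [0x425311], [0x431116], [0x431125], [0x431152], [0x431161],
   [0x431215], [0x431251], [0x431512], [0x431521], [0x431611], [0x432115], [0x432151], [0x432511],
   [0x435112], [0x435121], [0x435211], [0x436111], [0x451123], [0x451132], [0x451213], [0x451231],
   [0x451312], [0x451321], [0x452113], [0x452131], [0x452311], [0x453112], [0x453121], [0x453211],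
   [0x461113], [0x461131], [0x461311], [0x463111], [0x472111, 0x274111], [0x111247, 0x211147],
   [0x122137], [0x121237], [0x112237], [0x411127], [0x471211, 0x271411], [0x111256, 0x211156],
   [0x121156], [0x112156], [0x411136], [0x471121, 0x271141], [0x1b1111], [0x271114, 0x172114],
   [0x171124], [0x171214], [0x171223], [0x271123], [0x271213], [0x272113], [0x173113], [0x111265,
   0x211165], [0x122155], [0x121255], [0x112255], [0x211255], [0x212155], [0x221155], [0x411163],
   [0x131155], [0x113155], [0x111355], [0x111274, 0x211174], [0x122173], [0x121273], [0x112273],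
   [0x411172], [0x433321, 0x253321], [0x233521], [0x235321], [0x433312, 0x253312], [0x135511],
   [0x233512], [0x235312], [0x236311], [0x155311], [0x153511], [0x111427, 0x211417], [0x122317],
   [0x121417], [0x112417], [0x212227], [0x221227], [0x411217], [0x141217], [0x141127], [0x132217],
   [0x114217], [0x114127], [0x113227], [0x213127], [0x213217], [0x231127], [0x231217], [0x232117],
   [0x412117], [0x421117], [0x151117], [0x115117], [0x223117], [0x133117], [0x111436, 0x211435],
   [0x222433], [0x121453], [0x121435], [0x112453], [0x112435], [0x212236], [0x212263], [0x221236],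
   [0x221263], [0x411235], [0x411253], [0x411433], [0x211273], [0x211237], [0x141253], [0x141235],
   [0x141163], [0x141136], [0x132253], [0x132235], [0x114253], [0x114235], [0x114163], [0x114136],
   [0x113263], [0x113236], [0x213136], [0x213163], [0x213235], [0x231136], [0x231163], [0x231235],
   [0x232135], [0x412135], [0x412153], [0x414133], [0x421135], [0x421153], [0x441133], [0x221173],
   [0x221137], [0x216133], [0x212173], [0x212137], [0x171133], [0x151135], [0x131173], [0x131137],
   [0x115135], [0x113173], [0x113137], [0x223135], [0x261133], [0x133135], [0x111472, 0x211471],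
   [0x122371], [0x121471], [0x112471], [0x212272], [0x221272], [0x411271], [0x141271], [0x141172],
   [0x132271], [0x114271], [0x114172], [0x113272], [0x213172], [0x213271], [0x231172], [0x231271],
   [0x232171], [0x412171], [0x421171], [0x151171], [0x115171], [0x223171], [0x133171], [0x111616,
   0x211516], [0x121516], [0x112516], [0x411316], [0x433231, 0x253231], [0x233431], [0x235231],
   [0x433213, 0x253213], [0x233413], [0x235213], [0x155113], [0x235123], [0x253123], [0x433132,
   0x253132], [0x135151], [0x233152], [0x235132], [0x236131], [0x155131], [0x153151], [0x111625,
   0x211615], [0x122515], [0x121615], [0x112615], [0x211525], [0x212515], [0x221515], [0x411613],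
   [0x131515], [0x113515], [0x111346, 0x211345], [0x222343], [0x122335], [0x121543], [0x121345],
   [0x112543], [0x112345], [0x212326], [0x212335], [0x212623], [0x221326], [0x221623], [0x411325],
   [0x411343], [0x411523], [0x211327], [0x141613], [0x141523], [0x141325], [0x141316], [0x132613],
   [0x132325], [0x114613], [0x114523], [0x114325], [0x114316], [0x113623], [0x113335], [0x113326],
   [0x111517], [0x111373], [0x213316], [0x213325], [0x213613], [0x231316], [0x231325], [0x231613],
   [0x232315], [0x412315], [0x412513], [0x414313], [0x421315], [0x421513], [0x441313], [0x221317],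
   [0x216313], [0x212317], [0x171313], [0x151315], [0x131317], [0x115315], [0x113317], [0x223315],
   [0x261313], [0x133315], [0x233323], [0x432313, 0x252313], [0x232513], [0x234313], [0x153313],
   [0x151513], [0x231523], [0x251323], [0x432133, 0x252133], [0x232153], [0x234133], [0x151153],
   [0x231253], [0x431233], [0x427111, 0x247111], [0x111661, 0x211561], [0x121561], [0x112561],
   [0x411361], [0x423313, 0x243313], [0x115513], [0x213523], [0x215323], [0x223513], [0x225313],
   [0x135313], [0x133513], [0x111652, 0x211651], [0x122551], [0x121651], [0x112651], [0x211552],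
   [0x212551], [0x221551], [0x411631], [0x423133, 0x243133], [0x115153], [0x213253], [0x213433],
   [0x223153], [0x225133], [0x135133], [0x133153], [0x115333], [0x233233], [0x153133], [0x111364,
   0x211354], [0x222334], [0x122533], [0x122353], [0x121633], [0x121363], [0x112633], [0x112363],
   [0x211363], [0x211633], [0x212362], [0x212632], [0x221362], [0x221632], [0x411334], [0x411352],
   [0x411532], [0x211372], [0x211336], [0x141631], [0x141532], [0x141361], [0x141352], [0x132631],
   [0x132361], [0x114631], [0x114532], [0x114361], [0x114352], [0x113632], [0x113362], [0x111571],
   [0x111535], [0x111337], [0x213361], [0x213631], [0x221335], [0x231361], [0x231631], [0x412351],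
   [0x412531], [0x414331], [0x421351], [0x421531], [0x441331], [0x221371], [0x216331], [0x212371],
   [0x131371], [0x131335], [0x113371], [0x111724, 0x211714], [0x122713], [0x121723], [0x112723],
   [0x211723], [0x212713], [0x221713], [0x411712], [0x131713], [0x113713], [0x111733], [0x111742,
   0x211741], [0x122731], [0x121741], [0x112741], [0x211732], [0x212722], [0x212731], [0x221722],
   [0x411721], [0x141721], [0x141712], [0x132721], [0x114721], [0x114712], [0x113731], [0x113722],
   [0x111751], [0x213712], [0x213721], [0x221731], [0x231712], [0x231721], [0x232711], [0x412711],
   [0x421711], [0x151711], [0x131731], [0x115711], [0x223711], [0x133711], [0x117124, 0x217114],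
   [0x127213], [0x127123], [0x117223], [0x217123], [0x217213], [0x227113], [0x417112], [0x137113],
   [0x117313], [0x117133], [0x117142, 0x217141], [0x127231], [0x127141], [0x117241], [0x217132],
   [0x217222], [0x217231], [0x227122], [0x417121], [0x147121], [0x147112], [0x137221], [0x11b111],
   [0x117421], [0x117412], [0x117331], [0x117322], [0x117151], [0x217312], [0x217321], [0x227131],
   [0x237112], [0x237121], [0x237211], [0x157111], [0x137131], [0x117511], [0x227311], [0x137311],
   [0x171142, 0x471121], [0x172231], [0x172141], [0x171241], [0x271132], [0x271222], [0x271231],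
   [0x272122], [0x174121], [0x174112], [0x173221], [0x171421], [0x171412], [0x171331], [0x171322],
   [0x171151], [0x271312], [0x271321], [0x272131], [0x273112], [0x273121], [0x273211], [0x175111],
   [0x173131], [0x171511], [0x272311], [0x173311], [0x212353, 0x412333], [0x214333], [0x212533],
   [0x113533], [0x113353], [0x111553], [0x221353], [0x221533], [0x223333], [0x133333], [0x131533],
   [0x131353], [0x232333], [0x151333], [0x213352, 0x413332], [0x215332], [0x213532], [0x115531],
   [0x115351], [0x113551], [0x223351], [0x223531], [0x225331], [0x135331], [0x133351], [0x231352,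
   0x431332], [0x251332], [0x231532], [0x131551], [0x232351], [0x151351], [0x261331], [0x151531],
   [0x232531], [0x432331], [0x153331], [0x133531]]

/-- Passes the evaluated number `n` to `k`. -/
def force {α : Type} (n : ℕ) (k : ℕ → α) : α :=
  Nat.rec (motive := fun _ => α) (k 0) (fun m _ => k (Nat.succ m)) n

/-- The `c` with `e.choose c` odd. -/
def subs (e : ℕ) : List ℕ := (List.range (Nat.succ e)).filter fun c => Nat.beq (Nat.land e c) c

/-- The exponent vector `l`, written as a number. -/
def code (l : List ℕ) : ℕ := l.foldl (fun n e => Nat.add (Nat.mul 17 n) e) 0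

/-- Folds over the codes of the monomials of `Sqⁱ(x₁^{e₁} ⋯ x_k^{e_k})`, where `l` is the list of
the `e_j`, and `pre` is the code of a list to be prefixed. -/
def sqFold {α : Type} (op : ℕ → α → α) (l : List ℕ) : ℕ → ℕ → α → α :=
  List.rec (motive := fun _ => ℕ → ℕ → α → α)
    (fun i pre acc => bif Nat.beq i 0 then op pre acc else acc)
    (fun e l ih i pre acc =>
      List.rec (motive := fun _ => α)
        (bif Nat.beq (Nat.land e i) i then op (Nat.add (Nat.mul 17 pre) (Nat.add e i)) acc else acc)
        (fun _ _ _ => List.rec (motive := fun _ => α) acc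
          (fun c _ r => bif Nat.ble c i then
            ih (Nat.sub i c) (Nat.add (Nat.mul 17 pre) (Nat.add e c)) r else r) (subs e)) l) l

/-- Tests all vectors of `s` positive exponents with sum `n`. -/
def allExponents (s : ℕ) : ℕ → (List ℕ → Bool) → Bool :=
  Nat.rec (motive := fun _ => ℕ → (List ℕ → Bool) → Bool)
    (fun n p => bif Nat.beq n 0 then p [] else true)
    (fun s ih n p => Nat.rec (motive := fun _ => Bool) (bif Nat.beq n 0 then true else p [n])
      (fun _ _ => Nat.rec (motive := fun _ => Bool) true
        (fun e r => (ih (Nat.sub n (Nat.succ e)) fun l => p (Nat.succ e :: l)) && r) n) s) s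

/-- Tests whether `l` is a vector of `s` positive exponents with sum `n`. -/
def isExponent (s : ℕ) : List ℕ → ℕ → Bool :=
  Nat.rec (motive := fun _ => List ℕ → ℕ → Bool)
    (fun l n => List.rec (motive := fun _ => Bool) (Nat.beq n 0) (fun _ _ _ => false) l)
    (fun _ ih l n => List.rec (motive := fun _ => Bool) false
      (fun e l _ => Nat.ble 1 e && (Nat.ble e n && ih l (Nat.sub n e))) l) s

/-- The last `s` hexadecimal digits of `n`, prefixed to a list. -/
def digits (s : ℕ) : ℕ → List ℕ → List ℕ :=
  Nat.rec (motive := fun _ => ℕ → List ℕ → List ℕ) (fun _ acc => acc)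
    (fun _ ih n acc => ih (Nat.div n 16) (Nat.mod n 16 :: acc)) s

/-- The exponent vector encoded by `g`. -/
def unpack (s g : ℕ) : List ℕ := digits s g []

/-- The `i` of the hit polynomial `Sqⁱ f` encoded by `g`. -/
def sqDegree (s g : ℕ) : ℕ := Nat.div g (Nat.pow 16 s)

/-- Adds `x` to a sum over `𝔽₂`. -/
def toggle (x : ℕ) (L : List ℕ) : List ℕ :=
  List.rec (motive := fun _ => List ℕ) [x]
    (fun y L ih => bif Nat.beq x y then L else y :: ih) L

/-- The codes of the monomials of a sum of hit polynomials `Sqⁱ f`. -/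
def relationTerms (s : ℕ) (r : List ℕ) : List ℕ :=
  List.rec (motive := fun _ => List ℕ) [] (fun g r ih =>
    sqFold (List.rec (motive := fun _ => ℕ → List ℕ → List ℕ) List.cons (fun _ _ _ => toggle) r)
      (unpack s g) (sqDegree s g) 0 ih) r

/-- Tests whether `x` is in the set encoded by `K`. -/
def isKnown (K x : ℕ) : Bool := Nat.beq 1 (Nat.land 1 (Nat.shiftRight K (Nat.div x 17)))

def insertCode (K x : ℕ) : ℕ := Nat.lor K (Nat.shiftLeft 1 (Nat.div x 17))

def unknowns (K : ℕ) (L : List ℕ) : List ℕ :=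
  List.rec (motive := fun _ => List ℕ) [] (fun x _ ih => bif isKnown K x then ih else x :: ih) L

def validGen (s g : ℕ) : Bool :=
  Nat.ble 1 (sqDegree s g) && Nat.ble (sqDegree s g) 16 &&
    isExponent s (unpack s g) (Nat.sub 16 (sqDegree s g))

/-- Tests whether each of the relations `r` has at most one monomial that is not yet known, and
whether they make all monomials known in the end. -/
def spanCheck (s : ℕ) (r : List (List ℕ)) : ℕ → Bool :=
  List.rec (motive := fun _ => ℕ → Bool)
    (fun K => allExponents s 16 fun l => isKnown K (code l))
    (fun g _ ih K => g.all (validGen s) &&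
      List.rec (motive := fun _ => Bool) (ih K)
        (fun x u _ => List.rec (motive := fun _ => Bool) (force (insertCode K x) ih)
          (fun _ _ _ => false) u) (unknowns K (relationTerms s g))) r

def spans (s : ℕ) (B : List ℕ) (r : List (List ℕ)) : Bool :=
  spanCheck s r (B.foldl (fun K b => insertCode K (code (unpack s b))) 0)

def slot (x : ℕ) : ℕ := Nat.add 64 (Nat.mul 11 (Nat.mod (Nat.div x 17) 7559))

def position (U x : ℕ) : ℕ := Nat.land (Nat.shiftRight U (slot x)) 2047

/-- The entry of the monomial of code `x` in a table of entries of `w` binary digits.  The digits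
from the 64th on give the normal form. -/
def value (w U T x : ℕ) : ℕ :=
  Nat.land (Nat.shiftRight T (Nat.mul w (position U x))) (Nat.sub (Nat.pow 2 w) 2048)

def sumValue (w U T : ℕ) (L : List ℕ) : ℕ :=
  L.foldr (fun x n => Nat.xor (value w U T x) n) 0

def firstNew (U : ℕ) (L : List ℕ) : ℕ :=
  List.rec (motive := fun _ => ℕ) 0
    (fun x _ ih => bif Nat.beq (position U x) 0 then x else ih) L

def basisEntry (n : ℕ) : ℕ :=
  Nat.lor (Nat.shiftLeft 1 (Nat.add 63 n))
    (Nat.shiftLeft 1 (Nat.add 11 (Nat.mod (Nat.mul n 20) 53)))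

/-- Makes `v` the `n`-th entry of the table, for the monomial of code `x`. -/
def addEntry {α : Type} (w n U T x v : ℕ) (k : ℕ → ℕ → α) : α :=
  force (Nat.succ (Nat.lor U (Nat.shiftLeft n (slot x)))) fun U' =>
    force (Nat.succ (Nat.lor T (Nat.shiftLeft (Nat.lor n v) (Nat.mul w n)))) fun T' => k U' T'

/-- Enters the monomials given by relations into the table. -/
def enterRelations {α : Type} (s w : ℕ) (k : ℕ → ℕ → α) (r : List (List ℕ)) : ℕ → ℕ → ℕ → α :=
  List.rec (motive := fun _ => ℕ → ℕ → ℕ → α) (fun _ U T => k U T)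
    (fun g _ ih n U T => addEntry w n U T (firstNew U (relationTerms s g))
      (sumValue w U T (relationTerms s g)) (ih (Nat.succ n))) r

/-- Enters the basis monomials into the table. -/
def enterBasis {α : Type} (w : ℕ) (k : ℕ → ℕ → ℕ → α) (B : List ℕ) : ℕ → ℕ → ℕ → α :=
  List.rec (motive := fun _ => ℕ → ℕ → ℕ → α) k
    (fun x _ ih n U T => addEntry w n U T x (basisEntry n) (ih (Nat.succ n))) B

def withTable {α : Type} (s : ℕ) (B : List ℕ) (r : List (List ℕ)) (k : (ℕ → ℕ) → α) : α :=
  force (Nat.add 64 B.length) fun w =>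
    enterBasis w (enterRelations s w (fun U T => k (value w U T)) r)
      (B.map fun b => code (unpack s b)) 1 0 0

def weightAt (i : ℕ) (l : List ℕ) : ℕ :=
  l.foldr (fun e n => Nat.add (Nat.land (Nat.shiftRight e i) 1) n) 0

def weightKey (l : List ℕ) : ℕ :=
  Nat.add (weightAt 4 l) (Nat.mul 8 (Nat.add (weightAt 3 l) (Nat.mul 8
    (Nat.add (weightAt 2 l) (Nat.mul 8 (Nat.add (weightAt 1 l) (Nat.mul 8 (weightAt 0 l))))))))

/-- The place of a monomial in the order, as a number. -/
def key (l : List ℕ) : ℕ := l.foldl (fun n e => Nat.add (Nat.mul 32 n) e) (weightKey l)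

/-- Tests whether the list is increasing, with entries at least `p` and less than `2 ^ 64`. -/
def sortedFrom (l : List ℕ) : ℕ → Bool :=
  List.rec (motive := fun _ => ℕ → Bool) (fun _ => true)
    (fun x _ ih p => Nat.ble p x && (Nat.ble x 18446744073709551615 && ih x)) l

def pack (l : List ℕ) : ℕ := l.foldr (fun x n => Nat.add x (Nat.mul 18446744073709551616 n)) 0

def entry (K j : ℕ) : ℕ := Nat.land (Nat.shiftRight K (Nat.mul 64 j)) 18446744073709551615

/-- Tests whether normal forms do not increase monomials. -/
def orderCheck (N : ℕ → ℕ) (s : ℕ) (B : List ℕ) : Bool :=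
  sortedFrom (B.map fun b => key (unpack s b)) 0 &&
    force (pack (B.map fun b => key (unpack s b))) fun K => force B.length fun m =>
      allExponents s 16 fun x => force (N (code x)) fun n => bif Nat.beq n 0 then true else
        Nat.ble (Nat.succ (Nat.sub (Nat.log2 n) 64)) m &&
          Nat.ble (entry K (Nat.sub (Nat.log2 n) 64)) (key x)

/-- Tests whether the normal forms of the basis monomials are these monomials. -/
def diagCheck (N : ℕ → ℕ) (s : ℕ) (B : List ℕ) : ℕ → Bool :=
  List.rec (motive := fun _ => ℕ → Bool) (fun _ => true) (fun b _ ih p =>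
    Nat.beq (Nat.shiftRight (N (code (unpack s b))) 64) p && ih (Nat.mul 2 p)) B

/-- Tests whether the normal forms of the polynomials `Sqⁱ f` are zero. -/
def killCheck (N : ℕ → ℕ) (s : ℕ) : Bool :=
  (List.range 16).all fun i => allExponents s (Nat.sub 15 i) fun f =>
    Nat.beq (sqFold (fun x n => Nat.xor (N x) n) f (Nat.succ i) 0 0) 0

def basisCodes (s : ℕ) : List ℕ :=
  [[], basisCodes1, basisCodes2, basisCodes3, basisCodes4, basisCodes5].getD s []

def relationCodes (s : ℕ) : List (List ℕ) :=
  [[], relationCodes1, relationCodes2, relationCodes3, relationCodes4, relationCodes5].getD s []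

def basisCheck (s : ℕ) : Bool := (basisCodes s).all fun b => isExponent s (unpack s b) 16

def tableCheck (s : ℕ) : Bool :=
  withTable s (basisCodes s) (relationCodes s) fun N =>
    diagCheck N s (basisCodes s) 1 && (orderCheck N s (basisCodes s) && killCheck N s)

theorem basisCheck_eq_true : (List.range 6).all basisCheck = true := by decide +kernel

theorem spans_eq_true : ((List.range 6).all fun s =>
    spans s (basisCodes s) (relationCodes s)) = true := by decide +kernel

theorem tableCheck_eq_true : (List.range 6).all tableCheck = true := by decide +kernel

theorem choose_cast_zmod_two (n k : ℕ) :
    (n.choose k : ZMod 2) = if n &&& k = k then 1 else 0 := by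
  induction n using Nat.strong_induction_on generalizing k with
  | _ n ih =>
    rcases Nat.eq_zero_or_pos n with rfl | hn
    · cases k <;> simp
    · have h : (n.choose k : ZMod 2) =
          (((n % 2).choose (k % 2) * (n / 2).choose (k / 2) : ℕ) : ZMod 2) :=
        (ZMod.natCast_eq_natCast_iff _ _ _).2
          (haveI : Fact (Nat.Prime 2) := ⟨Nat.prime_two⟩
           Choose.choose_modEq_choose_mod_mul_choose_div_nat)
      rw [h, Nat.cast_mul, ih _ (Nat.div_lt_self hn one_lt_two)]
      have hk : n &&& k = k ↔ (n % 2 &&& k % 2 = k % 2) ∧ (n / 2 &&& k / 2 = k / 2) := by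
        rw [← Nat.and_div_two, ← Nat.and_mod_two_pow (n := 1)]
        omega
      have h2 : ((n % 2).choose (k % 2) : ZMod 2) = if n % 2 &&& k % 2 = k % 2 then 1 else 0 := by
        rcases Nat.mod_two_eq_zero_or_one n with h | h <;>
          rcases Nat.mod_two_eq_zero_or_one k with h' | h' <;> simp [h, h']
      rw [h2]
      simp only [hk]
      split_ifs <;> simp_all

theorem mem_subs {e c : ℕ} : c ∈ subs e ↔ e &&& c = c := by
  have : e &&& c = c → c < e + 1 := fun h => Nat.lt_succ_of_le (h ▸ Nat.and_le_left)
  simp only [subs, List.mem_filter, List.mem_range, Nat.beq_eq]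
  exact ⟨fun h => h.2, fun h => ⟨this h, h⟩⟩

theorem nodup_subs (e : ℕ) : (subs e).Nodup := List.nodup_range.filter _

/-- The exponent vectors of the monomials of `Sqⁱ(x₁^{e₁} ⋯ x_k^{e_k})`. -/
def sqTerms : ℕ → List ℕ → List (List ℕ)
  | i, [] => if i = 0 then [[]] else []
  | i, e :: l => (subs e).flatMap fun c =>
      if c ≤ i then (sqTerms (i - c) l).map (List.cons (e + c)) else []

theorem foldr_flatMap_op {α β : Type} (L : List ℕ) (h : ℕ → List β)
    (op : β → α → α) (acc : α) :
    (L.flatMap h).foldr op acc = L.foldr (fun c r => (h c).foldr op r) acc := by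
  induction L <;> simp_all

theorem flatMap_singleton_support (L : List ℕ) (hL : L.Nodup) (i : ℕ) {β : Type} (y : ℕ → β) :
    (L.flatMap fun c => if c ≤ i then (if i - c = 0 then [y c] else []) else []) =
      if i ∈ L then [y i] else [] := by
  induction L with
  | nil => simp
  | cons a L ih =>
    rw [List.nodup_cons] at hL
    rw [List.flatMap_cons, ih hL.2]
    by_cases h : a = i
    · subst h; simp [hL.1]
    · have : (if a ≤ i then (if i - a = 0 then [y a] else []) else []) = [] := by
        split_ifs <;> first | rfl | omega
      simp [this, Ne.symm h]

theorem sqTerms_singleton (i e : ℕ) :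
    sqTerms i [e] = if e &&& i = i then [[e + i]] else [] := by
  have := flatMap_singleton_support (subs e) (nodup_subs e) i (fun c => [e + c])
  simp only [mem_subs] at this
  rw [← this, sqTerms]
  congr 1; ext1 c
  split_ifs <;> simp [sqTerms, *]

theorem sqFold_cons {α : Type} (op : ℕ → α → α) (e e' : ℕ) (l : List ℕ) (i pre : ℕ) (acc : α) :
    sqFold op (e :: e' :: l) i pre acc = (subs e).foldr (fun c r => bif Nat.ble c i then
      sqFold op (e' :: l) (i - c) (17 * pre + (e + c)) r else r) acc := by
  rw [show sqFold op (e :: e' :: l) i pre acc = List.rec (motive := fun _ => α) acc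
          (fun c _ r => bif Nat.ble c i then
            sqFold op (e' :: l) (i - c) (17 * pre + (e + c)) r else r) (subs e) from rfl]
  induction subs e with
  | nil => rfl
  | cons c L ih => simp only [ih, List.foldr_cons]

theorem sqFold_eq {α : Type} (op : ℕ → α → α) (l : List ℕ) (i pre : ℕ) (acc : α) :
    sqFold op l i pre acc =
      ((sqTerms i l).map fun t => t.foldl (fun n e => 17 * n + e) pre).foldr op acc := by
  induction l generalizing i pre acc with
  | nil =>
    by_cases h : i = 0
    · simp [sqFold, sqTerms, h]
    · have : Nat.beq i 0 = false := by rw [Bool.eq_false_iff]; simpa using h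
      simp [sqFold, sqTerms, h, this]
  | cons e l ih =>
    cases l with
    | nil =>
      rw [sqTerms_singleton]
      by_cases h : e &&& i = i
      · rw [if_pos h]
        have : Nat.beq (e &&& i) i = true := by simpa using h
        simp [sqFold, this]
      · rw [if_neg h]
        have : Nat.beq (e &&& i) i = false := by
          rw [Bool.eq_false_iff]; simpa using h
        simp [sqFold, this]
    | cons e' l =>
      rw [sqFold_cons, sqTerms, List.map_flatMap, foldr_flatMap_op]
      congr 1
      ext c r
      by_cases h : c ≤ i
      · have : Nat.ble c i = true := by simpa using h
        rw [this, cond_true, ih, if_pos h, List.map_map]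
        rfl
      · have : Nat.ble c i = false := by rw [Bool.eq_false_iff]; simpa using h
        rw [this, cond_false, if_neg h]
        rfl

theorem mem_sqTerms {i : ℕ} {l t : List ℕ} (h : t ∈ sqTerms i l) :
    t.map (fun e => decide (0 < e)) = l.map (fun e => decide (0 < e)) ∧ t.sum = i + l.sum := by
  induction l generalizing i t with
  | nil =>
    by_cases hi : i = 0 <;> simp_all [sqTerms]
  | cons e l ih =>
    simp only [sqTerms, List.mem_flatMap] at h
    obtain ⟨c, hc, h⟩ := h
    split_ifs at h with hci
    · obtain ⟨t', ht', rfl⟩ := List.mem_map.1 h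
      obtain ⟨h1, h2⟩ := ih ht'
      rw [mem_subs] at hc
      have hce : c ≤ e := hc ▸ Nat.and_le_left
      simp only [List.map_cons, h1, List.sum_cons, h2]
      refine ⟨?_, by omega⟩
      congr 1
      simp only [decide_eq_decide]; omega
    · simp at h

theorem coeff_totalSq_var {R : Type*} [CommRing R] [Algebra (ZMod 2) R] (v : R) (e c : ℕ) :
    ((Polynomial.C v + Polynomial.C (v ^ 2) * Polynomial.X) ^ e).coeff c =
      (if e &&& c = c then v ^ (e + c) else 0) := by
  have h : (Polynomial.C v + Polynomial.C (v ^ 2) * Polynomial.X) ^ e =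
      Polynomial.C (v ^ e) * ((1 + Polynomial.X) ^ e).comp (Polynomial.C v * Polynomial.X) := by
    simp only [Polynomial.pow_comp, Polynomial.add_comp, Polynomial.one_comp, Polynomial.X_comp,
      map_pow, ← mul_pow]
    ring
  have h2 : ((e.choose c : ℕ) : R) = if e &&& c = c then 1 else 0 := by
    rw [← map_natCast (algebraMap (ZMod 2) R), choose_cast_zmod_two]
    split_ifs <;> simp
  rw [h, Polynomial.coeff_C_mul, Polynomial.comp_C_mul_X_coeff, Polynomial.coeff_one_add_X_pow, h2]
  split_ifs <;> simp [pow_add]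

theorem sum_flatMap {M : Type*} [AddCommMonoid M] {β : Type} (L : List ℕ) (h : ℕ → List β)
    (f : β → M) :
    ((L.flatMap h).map f).sum = (L.map fun c => ((h c).map f).sum).sum := by
  induction L <;> simp_all

theorem sum_subs {M : Type*} [AddCommMonoid M] (e i : ℕ) (f : ℕ → M) :
    ((subs e).map fun c => if c ≤ i then f c else 0).sum =
      ∑ c ∈ Finset.range (i + 1), if e &&& c = c then f c else 0 := by
  rw [← List.sum_toFinset _ (nodup_subs e), ← Finset.sum_filter, ← Finset.sum_filter]
  congr 1
  ext c
  simp [mem_subs, and_comm]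

theorem coeff_prod_totalSq {R : Type*} [CommRing R] [Algebra (ZMod 2) R] (vs : List R) (l : List ℕ)
    (h : vs.length = l.length) (i : ℕ) :
    (List.zipWith (fun (v : R) (e : ℕ) =>
      (Polynomial.C v + Polynomial.C (v ^ 2) * Polynomial.X) ^ e)
      vs l).prod.coeff i = ((sqTerms i l).map fun t => (List.zipWith (· ^ ·) vs t).prod).sum := by
  induction l generalizing vs i with
  | nil =>
    by_cases hi : i = 0 <;> simp [sqTerms, hi, Polynomial.coeff_one]
  | cons e l ih =>
    obtain _ | ⟨v, vs⟩ := vs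
    · simp at h
    · have h : vs.length = l.length := by simpa using h
      rw [List.zipWith_cons_cons, List.prod_cons, Polynomial.coeff_mul,
        Finset.Nat.sum_antidiagonal_eq_sum_range_succ_mk, sqTerms, sum_flatMap]
      have : ∀ c, (((if c ≤ i then (sqTerms (i - c) l).map (List.cons (e + c)) else []).map
          fun t => (List.zipWith (· ^ ·) (v :: vs) t).prod).sum) = if c ≤ i then
            v ^ (e + c) * ((sqTerms (i - c) l).map fun t => (List.zipWith (· ^ ·) vs t).prod).sum
             else 0 := by
        intro c
        split_ifs
        · rw [List.map_map, ← List.sum_map_mul_left]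
          simp [Function.comp_def]
        · simp
      simp only [this]
      rw [sum_subs]
      refine Finset.sum_congr rfl fun c _ => ?_
      rw [coeff_totalSq_var, ih _ h, ite_mul, zero_mul]

/-- The exponent vector given by a list. -/
def toF (l : List ℕ) : Fin 5 →₀ ℕ := Finsupp.equivFunOnFinite.symm fun j => l.getD j 0

/-- The monomial given by a list of exponents. -/
def ml (l : List ℕ) : P 5 := mono (toF l)

theorem toF_ofFn (a : Fin 5 →₀ ℕ) : toF (List.ofFn a) = a := by
  ext j
  fin_cases j <;> rfl

theorem exists_list_of_length_five {α : Type} {l : List α} (h : l.length = 5) :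
    ∃ a b c d e, l = [a, b, c, d, e] := by
  match l, h with
  | [a, b, c, d, e], _ => exact ⟨a, b, c, d, e, rfl⟩

theorem ml_eq_prod {l : List ℕ} (h : l.length = 5) :
    ml l = (List.zipWith (· ^ ·) [X 0, X 1, X 2, X 3, X 4] l).prod := by
  obtain ⟨a, b, c, d, e, rfl⟩ := exists_list_of_length_five h
  rw [ml, mono, monomial_eq, Finsupp.prod_fintype _ _ (by simp)]
  simp [Fin.prod_univ_five, toF, mul_assoc]

theorem Sq_ml {l : List ℕ} (h : l.length = 5) (i : ℕ) :
    Sq i 5 (ml l) = ((sqTerms i l).map ml).sum := by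
  have h1 : totalSq 5 (ml l) = (List.zipWith (fun (v : P 5) (e : ℕ) =>
      (Polynomial.C v + Polynomial.C (v ^ 2) * Polynomial.X) ^ e)
        [X 0, X 1, X 2, X 3, X 4] l).prod := by
    obtain ⟨a, b, c, d, e, rfl⟩ := exists_list_of_length_five h
    rw [ml_eq_prod rfl]
    simp [totalSq]
  have h2 : Sq i 5 (ml l) = (totalSq 5 (ml l)).coeff i := rfl
  rw [h2, h1, coeff_prod_totalSq _ _ (by simp [h])]
  congr 1
  refine List.map_congr_left fun t ht => (ml_eq_prod ?_).symm
  simpa [h] using congrArg List.length (mem_sqTerms ht).1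

theorem Sq_mem_hit {M : Submodule (ZMod 2) (P 5)} {f : P 5} (hf : f ∈ M) {i : ℕ} (hi : 1 ≤ i) :
    Sq i 5 f ∈ hit M :=
  Submodule.subset_span ⟨fun n => Sq i n, NonUnitalAlgebra.subset_adjoin _ ⟨i, hi, rfl⟩, f, hf, rfl⟩

theorem hit_mono {M N : Submodule (ZMod 2) (P 5)} (h : M ≤ N) : hit M ≤ hit N :=
  Submodule.span_mono fun _ ⟨θ, hθ, f, hf, e⟩ => ⟨θ, hθ, f, h hf, e⟩

theorem hit_le_ker {V : Type*} [AddCommGroup V] [Module (ZMod 2) V] (φ : P 5 →ₗ[ZMod 2] V)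
    (h : ∀ i, 1 ≤ i → ∀ f, φ (Sq i 5 f) = 0) (M : Submodule (ZMod 2) (P 5)) :
    hit M ≤ LinearMap.ker φ := by
  have key : ∀ θ ∈ APlus, ∀ f, φ (θ 5 f) = 0 := by
    intro θ hθ
    induction hθ using NonUnitalAlgebra.adjoin_induction with
    | mem θ hθ => obtain ⟨i, hi, rfl⟩ := hθ; exact h i hi
    | add x y _ _ hx hy => intro f; simp [hx, hy]
    | zero => simp
    | mul x y _ _ hx hy => intro f; exact hx (y 5 f)
    | smul r x _ hx => intro f; simp [hx]
  rw [hit, Submodule.span_le]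
  rintro _ ⟨θ, hθ, f, _, rfl⟩
  exact key θ hθ f

/-- The support of an exponent vector. -/
def supp (l : List ℕ) : List Bool := l.map fun e => decide (0 < e)

theorem force_eq {α : Type} (n : ℕ) (k : ℕ → α) : force n k = k n := by
  cases n <;> rfl

theorem supp_eq_cons {t : List ℕ} {b : Bool} {S : List Bool} (h : supp t = b :: S) :
    ∃ e t', t = e :: t' ∧ decide (0 < e) = b ∧ supp t' = S := by
  cases t with
  | nil => simp [supp] at h
  | cons e t => exact ⟨e, t, rfl, by simpa [supp] using h⟩

theorem length_supp (l : List ℕ) : (supp l).length = l.length := by simp [supp]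

/-- The vectors of `s` positive exponents with sum 16. -/
def IsExponent (s : ℕ) (t : List ℕ) : Prop := supp t = List.replicate s true ∧ t.sum = 16

theorem IsExponent.length {s : ℕ} {t : List ℕ} (h : IsExponent s t) : t.length = s := by
  rw [← length_supp, h.1, List.length_replicate]

theorem allExponents_spec {s n : ℕ} {p : List ℕ → Bool} (h : allExponents s n p = true)
    {t : List ℕ} (ht : supp t = List.replicate s true) (hn : t.sum = n) : p t = true := by
  induction s generalizing n p t with
  | zero =>
    obtain rfl : t = [] := by simpa [supp] using ht
    obtain rfl : 0 = n := by simpa using hn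
    exact h
  | succ s ih =>
    obtain ⟨e, t, rfl, he, ht'⟩ := supp_eq_cons ht
    clear ht
    rw [List.sum_cons] at hn
    have he : 0 < e := by simpa using he
    cases s with
    | zero =>
      obtain rfl : t = [] := by simpa [supp] using ht'
      obtain rfl : e = n := by simpa using hn
      rw [show allExponents 1 e p = (bif Nat.beq e 0 then true else p [e]) from rfl,
        show Nat.beq e 0 = false by rw [Bool.eq_false_iff]; simp; omega] at h
      exact h
    | succ s =>
      have key : ∀ m, Nat.rec (motive := fun _ => Bool) true
          (fun e r => (allExponents (s + 1) (n - (e + 1)) fun l => p ((e + 1) :: l)) && r) m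
            = true → ∀ e < m, allExponents (s + 1) (n - (e + 1)) (fun l => p ((e + 1) :: l))
            = true := by
        intro m
        induction m with
        | zero => simp
        | succ m ihm =>
          intro hm e he
          have hm := (Bool.and_eq_true _ _).mp hm
          rcases Nat.lt_succ_iff_lt_or_eq.1 he with he | rfl
          · exact ihm hm.2 e he
          · exact hm.1
      have := ih (key n h (e - 1) (by omega)) ht' (by omega)
      rwa [Nat.sub_add_cancel he] at this

theorem isExponent_spec {s : ℕ} {l : List ℕ} {n : ℕ} (h : isExponent s l n = true) :
    supp l = List.replicate s true ∧ l.sum = n := by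
  induction s generalizing l n with
  | zero =>
    cases l with
    | nil => exact ⟨rfl, (Nat.eq_of_beq_eq_true h).symm⟩
    | cons => cases h
  | succ s ih =>
    cases l with
    | nil => cases h
    | cons e l =>
      obtain ⟨h1, h2⟩ := (Bool.and_eq_true _ _).mp h
      obtain ⟨h2, h3⟩ := (Bool.and_eq_true _ _).mp h2
      obtain ⟨h4, h5⟩ := ih h3
      refine ⟨?_, ?_⟩
      · rw [List.replicate_succ, ← h4]
        exact congrArg (· :: supp l) (decide_eq_true (Nat.le_of_ble_eq_true h1))
      · rw [List.sum_cons, h5]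
        exact Nat.add_sub_cancel' (Nat.le_of_ble_eq_true h2)

theorem eq_of_code_div_of_length {t u : List ℕ} (h : t.length = 5) (hs : t.sum = 16)
    (h' : u.length = 5) (hs' : u.sum = 16) (e : code t / 17 = code u / 17) : t = u := by
  obtain ⟨a, b, c, d, x, rfl⟩ := exists_list_of_length_five h
  obtain ⟨a', b', c', d', x', rfl⟩ := exists_list_of_length_five h'
  simp only [List.sum_cons, List.sum_nil] at hs hs'
  simp only [code, List.foldl_cons, List.foldl_nil, Nat.add_eq, Nat.mul_eq] at e
  have step {p q y z : ℕ} (hy : y ≤ 16) (hz : z ≤ 16) (h : 17 * p + y = 17 * q + z) :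
      p = q ∧ y = z := by omega
  have div {x y : ℕ} (h : y ≤ 16) : (17 * x + y) / 17 = x := by omega
  rw [div (by omega : x ≤ 16), div (by omega : x' ≤ 16)] at e
  obtain ⟨e1, rfl⟩ := step (by omega) (by omega) e
  obtain ⟨e2, rfl⟩ := step (by omega) (by omega) e1
  obtain ⟨e3, rfl⟩ := step (by omega) (by omega) e2
  obtain ⟨e4, rfl⟩ := step (by omega) (by omega) e3
  obtain rfl : x = x' := by omega
  rfl

theorem code_replicate_append (k : ℕ) (t : List ℕ) : code (List.replicate k 0 ++ t) = code t := by
  induction k with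
  | zero => rfl
  | succ k ih => exact ih

theorem eq_of_code_div {s : ℕ} (hs : s ≤ 5) {t u : List ℕ} (ht : IsExponent s t)
    (hu : IsExponent s u) (e : code t / 17 = code u / 17) : t = u := by
  refine List.append_cancel_left (as := List.replicate (5 - s) 0)
    (eq_of_code_div_of_length ?_ ?_ ?_ ?_ ?_)
  · simp [ht.length]; omega
  · simp [ht.2]
  · simp [hu.length]; omega
  · simp [hu.2]
  · simpa only [code_replicate_append] using e

/-- The exponent vector of code `c`. -/
def decode (s c : ℕ) : List ℕ := Classical.epsilon fun t => IsExponent s t ∧ code t = c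

theorem decode_code {s : ℕ} (hs : s ≤ 5) {t : List ℕ} (ht : IsExponent s t) :
    decode s (code t) = t := by
  have h := Classical.epsilon_spec (p := fun u => IsExponent s u ∧ code u = code t) ⟨t, ht, rfl⟩
  exact eq_of_code_div hs h.1 ht (congrArg (· / 17) h.2)

theorem isKnown_eq (K x : ℕ) : isKnown K x = K.testBit (x / 17) := by
  rw [show isKnown K x = Nat.beq 1 (1 &&& K >>> (x / 17)) from rfl, Nat.testBit,
    Nat.one_and_eq_mod_two]
  rcases Nat.mod_two_eq_zero_or_one (K >>> (x / 17)) with h | h <;> rw [h] <;> rfl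

theorem isKnown_insertCode {K x y : ℕ} (h : isKnown (insertCode K x) y = true) :
    isKnown K y = true ∨ x / 17 = y / 17 := by
  rw [isKnown_eq] at h ⊢
  rw [show insertCode K x = K ||| 1 <<< (x / 17) from rfl, Nat.one_shiftLeft, Nat.testBit_or,
    Nat.testBit_two_pow, Bool.or_eq_true, decide_eq_true_eq] at h
  exact h

theorem sum_toggle (f : ℕ → P 5) (x : ℕ) (L : List ℕ) :
    ((toggle x L).map f).sum = f x + (L.map f).sum := by
  induction L with
  | nil => simp [toggle]
  | cons y L ih =>
    rw [show toggle x (y :: L) = bif Nat.beq x y then L else y :: toggle x L from rfl]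
    cases h : Nat.beq x y with
    | true =>
      rw [Nat.eq_of_beq_eq_true h, cond_true, List.map_cons, List.sum_cons, ← add_assoc,
        CharTwo.add_self_eq_zero, zero_add]
    | false => rw [cond_false, List.map_cons, List.sum_cons, List.map_cons, List.sum_cons, ih,
        add_left_comm]

theorem mem_toggle {x z : ℕ} {L : List ℕ} (h : z ∈ toggle x L) : z = x ∨ z ∈ L := by
  induction L with
  | nil => simpa [toggle] using h
  | cons y L ih =>
    rw [show toggle x (y :: L) = bif Nat.beq x y then L else y :: toggle x L from rfl] at h
    cases h' : Nat.beq x y with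
    | true => rw [h', cond_true] at h; simp [h]
    | false =>
      rw [h', cond_false, List.mem_cons] at h
      rcases h with rfl | h
      · simp
      · rcases ih h with h | h <;> simp [h]

theorem sum_foldr_op {op : ℕ → List ℕ → List ℕ} {f : ℕ → P 5}
    (hop : ∀ x L, ((op x L).map f).sum = f x + (L.map f).sum) (M L : List ℕ) :
    ((M.foldr op L).map f).sum = (M.map f).sum + (L.map f).sum := by
  induction M with
  | nil => simp
  | cons x M ih => rw [List.foldr_cons, hop, ih, List.map_cons, List.sum_cons, add_assoc]

theorem mem_foldr_op {op : ℕ → List ℕ → List ℕ} (hop : ∀ x z L, z ∈ op x L → z = x ∨ z ∈ L)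
    {M L : List ℕ} {z : ℕ} (h : z ∈ M.foldr op L) : z ∈ M ∨ z ∈ L := by
  induction M with
  | nil => exact Or.inr h
  | cons x M ih =>
    rcases hop _ _ _ h with rfl | h
    · simp
    · rcases ih h with h | h <;> simp [h]

theorem validGen_spec {s g : ℕ} (h : validGen s g = true) :
    1 ≤ sqDegree s g ∧ supp (unpack s g) = List.replicate s true ∧
      sqDegree s g + (unpack s g).sum = 16 := by
  obtain ⟨h1, h2⟩ := (Bool.and_eq_true _ _).mp h
  obtain ⟨h1, h3⟩ := (Bool.and_eq_true _ _).mp h1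
  obtain ⟨h4, h5⟩ := isExponent_spec h2
  exact ⟨Nat.le_of_ble_eq_true h1, h4, h5 ▸ Nat.add_sub_cancel' (Nat.le_of_ble_eq_true h3)⟩

theorem sum_relationTerms (s : ℕ) (r : List ℕ) (f : ℕ → P 5) :
    ((relationTerms s r).map f).sum = (r.map fun g =>
      ((sqTerms (sqDegree s g) (unpack s g)).map fun t => f (code t)).sum).sum := by
  induction r with
  | nil => rfl
  | cons g r ih =>
    have : ((relationTerms s (g :: r)).map f).sum =
      ((sqTerms (sqDegree s g) (unpack s g)).map fun t => f (code t)).sum +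
        ((relationTerms s r).map f).sum := by
      cases r with
      | nil =>
        rw [show relationTerms s [g] = sqFold List.cons (unpack s g) (sqDegree s g) 0
          (relationTerms s []) from rfl, sqFold_eq, sum_foldr_op fun x L => by simp, List.map_map]
        rfl
      | cons g' r =>
        rw [show relationTerms s (g :: g' :: r) = sqFold toggle (unpack s g) (sqDegree s g) 0
          (relationTerms s (g' :: r)) from rfl, sqFold_eq, sum_foldr_op (sum_toggle f),
        List.map_map]
        rfl
    rw [this, ih, List.map_cons, List.sum_cons]

theorem mem_relationTerms {s : ℕ} {r : List ℕ} {z : ℕ} (h : z ∈ relationTerms s r) :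
    ∃ g ∈ r, ∃ t ∈ sqTerms (sqDegree s g) (unpack s g), z = code t := by
  induction r with
  | nil => cases h
  | cons g r ih =>
    have : z ∈ (sqTerms (sqDegree s g) (unpack s g)).map code ∨ z ∈ relationTerms s r := by
      cases r with
      | nil =>
        rw [show relationTerms s [g] = sqFold List.cons (unpack s g) (sqDegree s g) 0
          (relationTerms s []) from rfl, sqFold_eq] at h
        exact mem_foldr_op (fun x z L h => List.mem_cons.1 h) h
      | cons g' r =>
        rw [show relationTerms s (g :: g' :: r) = sqFold toggle (unpack s g) (sqDegree s g) 0
          (relationTerms s (g' :: r)) from rfl, sqFold_eq] at h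
        exact mem_foldr_op (fun x z L h => mem_toggle h) h
    rcases this with h | h
    · obtain ⟨t, ht, rfl⟩ := List.mem_map.1 h
      exact ⟨g, by simp, t, ht, rfl⟩
    · obtain ⟨g', hg', h⟩ := ih h
      exact ⟨g', by simp [hg'], h⟩

/-- `W` contains `∑ m t` over the terms `t` of each `Sqⁱ f` with `f` of `s` variables. -/
def ContainsHits (s : ℕ) (m : List ℕ → P 5) (W : Submodule (ZMod 2) (P 5)) : Prop :=
  ∀ i f, 1 ≤ i → supp f = List.replicate s true → ((sqTerms i f).map m).sum ∈ W

theorem relationTerms_spec {s : ℕ} (hs : s ≤ 5) {m : List ℕ → P 5}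
    {W : Submodule (ZMod 2) (P 5)} (hW : ContainsHits s m W) {r : List ℕ}
    (h : r.all (validGen s) = true) :
    (∀ z ∈ relationTerms s r, ∃ t, IsExponent s t ∧ z = code t) ∧
      ((relationTerms s r).map fun z => m (decode s z)).sum ∈ W := by
  rw [List.all_eq_true] at h
  have key : ∀ g ∈ r, ∀ t ∈ sqTerms (sqDegree s g) (unpack s g), IsExponent s t := by
    intro g hg t ht
    obtain ⟨_, h2, h3⟩ := validGen_spec (h g hg)
    obtain ⟨h4, h5⟩ := mem_sqTerms ht
    exact ⟨h4.trans h2, h5.trans h3⟩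
  refine ⟨fun z hz => ?_, ?_⟩
  · obtain ⟨g, hg, t, ht, rfl⟩ := mem_relationTerms hz
    exact ⟨t, key g hg t ht, rfl⟩
  · rw [sum_relationTerms s r fun z => m (decode s z)]
    refine list_sum_mem fun x hx => ?_
    obtain ⟨g, hg, rfl⟩ := List.mem_map.1 hx
    obtain ⟨h1, h2, h3⟩ := validGen_spec (h g hg)
    have : (sqTerms (sqDegree s g) (unpack s g)).map (fun t => m (decode s (code t))) =
        (sqTerms (sqDegree s g) (unpack s g)).map m :=
      List.map_congr_left fun t ht => by rw [decode_code hs (key g hg t ht)]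
    rw [this]
    exact hW _ _ h1 h2

theorem sum_unknowns {K : ℕ} {L : List ℕ} {f : ℕ → P 5} {W : Submodule (ZMod 2) (P 5)}
    (h : ∀ z ∈ L, isKnown K z = true → f z ∈ W) (hL : (L.map f).sum ∈ W) :
    ((unknowns K L).map f).sum ∈ W := by
  suffices (L.map f).sum - ((unknowns K L).map f).sum ∈ W by
    simpa using W.sub_mem hL this
  clear hL
  induction L with
  | nil => simp [unknowns]
  | cons x L ih =>
    have ih := ih fun z hz => h z (by simp [hz])
    rw [show unknowns K (x :: L) =
      bif isKnown K x then unknowns K L else x :: unknowns K L from rfl]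
    cases hx : isKnown K x with
    | true =>
      rw [cond_true, List.map_cons, List.sum_cons, add_sub_assoc]
      exact W.add_mem (h x (by simp) hx) ih
    | false => simpa using ih

theorem mem_of_mem_unknowns {K z : ℕ} {L : List ℕ} (h : z ∈ unknowns K L) : z ∈ L := by
  induction L with
  | nil => exact h
  | cons x L ih =>
    rw [show unknowns K (x :: L) =
      bif isKnown K x then unknowns K L else x :: unknowns K L from rfl]
      at h
    cases hx : isKnown K x with
    | true => rw [hx] at h; simp [ih h]
    | false =>
      rw [hx, cond_false, List.mem_cons] at h
      rcases h with rfl | h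
      · simp
      · simp [ih h]

theorem spanCheck_spec {s : ℕ} (hs : s ≤ 5) {m : List ℕ → P 5}
    {W : Submodule (ZMod 2) (P 5)} (hW : ContainsHits s m W) {r : List (List ℕ)} {K : ℕ}
    (h : spanCheck s r K = true)
    (hK : ∀ t, IsExponent s t → isKnown K (code t) = true → m t ∈ W) {t : List ℕ}
    (ht : IsExponent s t) : m t ∈ W := by
  induction r generalizing K with
  | nil => exact hK t ht (allExponents_spec (p := fun l => isKnown K (code l)) h ht.1 ht.2)
  | cons g r ih =>
    obtain ⟨h1, h2⟩ := (Bool.and_eq_true _ _).mp h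
    obtain ⟨h3, h4⟩ := relationTerms_spec hs hW h1
    have h5 := sum_unknowns (K := K) (fun z hz hk => by
      obtain ⟨t, ht, rfl⟩ := h3 z hz
      rw [decode_code hs ht]
      exact hK t ht hk) h4
    have h6 : ∀ z ∈ unknowns K (relationTerms s g), ∃ t, IsExponent s t ∧ z = code t :=
      fun z hz => h3 z (mem_of_mem_unknowns hz)
    generalize unknowns K (relationTerms s g) = u at h2 h5 h6
    match u, h2, h5, h6 with
    | [], h2, _, _ => exact ih h2 hK
    | [x], h2, h5, h6 =>
      have h2 : force (insertCode K x) (spanCheck s r) = true := h2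
      rw [force_eq] at h2
      obtain ⟨u, hu, rfl⟩ := h6 x (by simp)
      rw [List.map_singleton, List.sum_singleton, decode_code hs hu] at h5
      refine ih h2 fun t ht hk => ?_
      rcases isKnown_insertCode hk with hk | hk
      · exact hK t ht hk
      · rwa [← eq_of_code_div hs hu ht hk]

theorem isKnown_foldl_insertCode {s : ℕ} (B : List ℕ) {K x : ℕ}
    (h : isKnown (B.foldl (fun K b => insertCode K (code (unpack s b))) K) x = true) :
    isKnown K x = true ∨ ∃ b ∈ B, code (unpack s b) / 17 = x / 17 := by
  induction B generalizing K with
  | nil => exact Or.inl h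
  | cons b B ih =>
    rcases ih h with h | ⟨b', hb', h⟩
    · rcases isKnown_insertCode h with h | h
      · exact Or.inl h
      · exact Or.inr ⟨b, by simp, h⟩
    · exact Or.inr ⟨b', by simp [hb'], h⟩

/-- The exponent vectors, without zeros, of the admissible monomials of degree 16 with `s`
variables. -/
def shortBasis (s : ℕ) : List (List ℕ) := (basisCodes s).map (unpack s)

theorem isExponent_of_mem_shortBasis {s : ℕ} (hs : s ≤ 5) {b : List ℕ} (hb : b ∈ shortBasis s) :
    IsExponent s b := by
  obtain ⟨c, hc, rfl⟩ := List.mem_map.1 hb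
  have h := List.all_eq_true.1 basisCheck_eq_true s (List.mem_range.2 (by omega))
  exact isExponent_spec (List.all_eq_true.1 h c hc)

theorem mem_of_containsHits {s : ℕ} (hs : s ≤ 5) {m : List ℕ → P 5}
    {W : Submodule (ZMod 2) (P 5)} (hW : ContainsHits s m W) (hB : ∀ b ∈ shortBasis s, m b ∈ W)
    {t : List ℕ} (ht : IsExponent s t) : m t ∈ W := by
  have h := List.all_eq_true.1 spans_eq_true s (List.mem_range.2 (by omega))
  refine spanCheck_spec hs hW h (fun t ht hk => ?_) ht
  rcases isKnown_foldl_insertCode _ hk with hk | ⟨b, hb, h⟩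
  · simp [isKnown_eq] at hk
  · have hb := List.mem_map_of_mem (f := unpack s) hb
    rw [← eq_of_code_div hs (isExponent_of_mem_shortBasis hs hb) ht h]
    exact hB _ hb

theorem exists_enterRelations (s w : ℕ) (r : List (List ℕ)) (n U T : ℕ) :
    ∃ U' T', ∀ k : ℕ → ℕ → Bool, enterRelations s w k r n U T = k U' T' := by
  induction r generalizing n U T with
  | nil => exact ⟨U, T, fun k => rfl⟩
  | cons g r ih =>
    obtain ⟨U', T', h⟩ := ih (Nat.succ n)
      (Nat.succ (Nat.lor U (Nat.shiftLeft n (slot (firstNew U (relationTerms s g))))))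
      (Nat.succ (Nat.lor T (Nat.shiftLeft (Nat.lor n (sumValue w U T (relationTerms s g)))
        (Nat.mul w n))))
    exact ⟨U', T', fun k => (force_eq _ _).trans ((force_eq _ _).trans (h k))⟩

theorem exists_enterBasis (w : ℕ) (B : List ℕ) (n U T : ℕ) :
    ∃ n' U' T', ∀ k : ℕ → ℕ → ℕ → Bool, enterBasis w k B n U T = k n' U' T' := by
  induction B generalizing n U T with
  | nil => exact ⟨n, U, T, fun k => rfl⟩
  | cons x B ih =>
    obtain ⟨n', U', T', h⟩ := ih (Nat.succ n) (Nat.succ (Nat.lor U (Nat.shiftLeft n (slot x))))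
      (Nat.succ (Nat.lor T (Nat.shiftLeft (Nat.lor n (basisEntry n)) (Nat.mul w n))))
    exact ⟨n', U', T', fun k => (force_eq _ _).trans ((force_eq _ _).trans (h k))⟩

theorem exists_withTable (s : ℕ) (B : List ℕ) (r : List (List ℕ)) :
    ∃ N : ℕ → ℕ, ∀ k : (ℕ → ℕ) → Bool, withTable s B r k = k N := by
  obtain ⟨n, U, T, h⟩ := exists_enterBasis (64 + B.length) (B.map fun b => code (unpack s b)) 1 0 0
  obtain ⟨U', T', h'⟩ := exists_enterRelations s (64 + B.length) r n U T
  exact ⟨value (64 + B.length) U' T', fun k => (force_eq _ _).trans ((h _).trans (h' _))⟩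

theorem diagCheck_spec {N : ℕ → ℕ} {s : ℕ} {B : List ℕ} {p : ℕ}
    (h : diagCheck N s B p = true) (j : ℕ) (hj : j < B.length) :
    N (code (unpack s B[j])) >>> 64 = 2 ^ j * p := by
  induction B generalizing p j with
  | nil => simp at hj
  | cons b B ih =>
    obtain ⟨h1, h2⟩ := (Bool.and_eq_true _ _).mp h
    cases j with
    | zero => simpa using Nat.eq_of_beq_eq_true h1
    | succ j =>
      have := ih h2 j (by simpa using hj)
      rw [List.getElem_cons_succ, this, Nat.mul_eq, pow_succ, mul_assoc]

theorem killCheck_spec {N : ℕ → ℕ} {s : ℕ} (h : killCheck N s = true) {f : List ℕ}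
    (hf : supp f = List.replicate s true) {i : ℕ} (hi : 1 ≤ i) (hif : i + f.sum = 16) :
    ((sqTerms i f).map fun t => N (code t)).foldr (· ^^^ ·) 0 = 0 := by
  have h1 := List.all_eq_true.1 h (i - 1) (List.mem_range.2 (by omega))
  have h2 := allExponents_spec h1 hf (by rw [Nat.sub_eq]; omega)
  have h3 := Nat.eq_of_beq_eq_true h2
  rw [Nat.succ_eq_add_one, Nat.sub_add_cancel hi, sqFold_eq, List.foldr_map] at h3
  rw [List.foldr_map]
  exact h3

theorem sortedFrom_spec {l : List ℕ} {p : ℕ} (h : sortedFrom l p = true) :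
    (∀ x ∈ l, p ≤ x ∧ x < 2 ^ 64) ∧ l.Pairwise (· ≤ ·) := by
  induction l generalizing p with
  | nil => simp
  | cons x l ih =>
    obtain ⟨h1, h2⟩ := (Bool.and_eq_true _ _).mp h
    obtain ⟨h2, h3⟩ := (Bool.and_eq_true _ _).mp h2
    have h1 := Nat.le_of_ble_eq_true h1
    have h2 := Nat.le_of_ble_eq_true h2
    obtain ⟨h4, h5⟩ := ih h3
    exact ⟨List.forall_mem_cons.2 ⟨⟨h1, by omega⟩, fun y hy => ⟨h1.trans (h4 y hy).1, (h4 y hy).2⟩⟩,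
      List.pairwise_cons.2 ⟨fun y hy => (h4 y hy).1, h5⟩⟩

theorem entry_pack {l : List ℕ} (h : ∀ x ∈ l, x < 2 ^ 64) {j : ℕ} (hj : j < l.length) :
    entry (pack l) j = l[j] := by
  have he (K j : ℕ) : entry K j = K / 2 ^ (64 * j) % 2 ^ 64 := by
    rw [← Nat.shiftRight_eq_div_pow, ← Nat.and_two_pow_sub_one_eq_mod]
    rfl
  induction l generalizing j with
  | nil => simp at hj
  | cons x l ih =>
    have hx : x < 2 ^ 64 := h x (by simp)
    have hp : pack (x :: l) = x + 2 ^ 64 * pack l := rfl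
    cases j with
    | zero => rw [he, hp, mul_zero, pow_zero, Nat.div_one, Nat.add_mul_mod_self_left,
        Nat.mod_eq_of_lt hx, List.getElem_cons_zero]
    | succ j =>
      rw [he, hp, mul_add, mul_one, add_comm (64 * j), pow_add, ← Nat.div_div_eq_div_mul,
        Nat.add_mul_div_left _ _ (by norm_num), Nat.div_eq_of_lt hx, zero_add, ← he,
        ih (fun y hy => h y (by simp [hy])) (by simpa using hj), List.getElem_cons_succ]

theorem orderCheck_spec {N : ℕ → ℕ} {s : ℕ} {B : List ℕ} (h : orderCheck N s B = true)
    {t : List ℕ} (ht : IsExponent s t) {j : ℕ} (hj : j < B.length)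
    (hb : (N (code t) >>> 64).testBit j = true) : key (unpack s B[j]) ≤ key t := by
  obtain ⟨h1, h2⟩ := (Bool.and_eq_true _ _).mp h
  rw [force_eq, force_eq] at h2
  have h3 := allExponents_spec h2 ht.1 ht.2
  rw [force_eq] at h3
  rw [Nat.testBit_shiftRight] at hb
  have h0 : N (code t) ≠ 0 := by
    rintro h0
    simp [h0] at hb
  have hbeq : Nat.beq (N (code t)) 0 = false := by rw [Bool.eq_false_iff]; simpa using h0
  rw [hbeq, cond_false] at h3
  obtain ⟨h4, h5⟩ := (Bool.and_eq_true _ _).mp h3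
  have h4 : (N (code t)).log2 - 64 < B.length := Nat.le_of_ble_eq_true h4
  have h4' : (N (code t)).log2 - 64 < (B.map fun b => key (unpack s b)).length := by simpa using h4
  obtain ⟨h6, h7⟩ := sortedFrom_spec h1
  have h5 := Nat.le_of_ble_eq_true h5
  rw [Nat.sub_eq, entry_pack (fun x hx => (h6 x hx).2) h4'] at h5
  have h8 : 64 + j ≤ (N (code t)).log2 := (Nat.le_log2 h0).2 (Nat.ge_two_pow_of_testBit hb)
  refine le_trans ?_ h5
  have h9 (n : ℕ) (hn : n < (B.map fun b => key (unpack s b)).length) (hjn : j ≤ n) :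
      (B.map fun b => key (unpack s b))[j]'(by simpa using hj) ≤
        (B.map fun b => key (unpack s b))[n] := by
    rcases hjn.eq_or_lt with rfl | hjn
    · exact le_rfl
    · exact List.pairwise_iff_getElem.1 h7 j n _ hn hjn
  rw [← List.getElem_map (fun b => key (unpack s b)) (h := by simpa using hj)]
  exact h9 _ h4' (by omega)

theorem weight_toF {l : List ℕ} (h : l.length = 5) (i : ℕ) : weight (toF l) i = weightAt i l := by
  obtain ⟨a, b, c, d, e, rfl⟩ := exists_list_of_length_five h
  simp [weight, weightAt, Fin.sum_univ_five, toF, Nat.shiftRight_eq_div_pow, add_assoc]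

theorem weightAt_le {l : List ℕ} (h : l.length = 5) (i : ℕ) : weightAt i l ≤ 5 := by
  obtain ⟨a, b, c, d, e, rfl⟩ := exists_list_of_length_five h
  simp only [weightAt, List.foldr_cons, List.foldr_nil, Nat.add_eq, Nat.land_eq,
    Nat.and_one_is_mod]
  omega

theorem weightAt_eq_zero {l : List ℕ} (h : l.length = 5) (hs : l.sum = 16) {i : ℕ} (hi : 5 ≤ i) :
    weightAt i l = 0 := by
  have h0 : ∀ e, e ≤ 16 → e / 2 ^ i = 0 := fun e he =>
    Nat.div_eq_of_lt (lt_of_lt_of_le (by omega : e < 2 ^ 5) (Nat.pow_le_pow_right two_pos hi))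
  obtain ⟨a, b, c, d, e, rfl⟩ := exists_list_of_length_five h
  simp only [List.sum_cons, List.sum_nil] at hs
  simp only [weightAt, List.foldr_cons, List.foldr_nil, Nat.add_eq, Nat.land_eq,
    Nat.and_one_is_mod, Nat.shiftRight_eq, Nat.shiftRight_eq_div_pow]
  rw [h0 a (by omega), h0 b (by omega), h0 c (by omega), h0 d (by omega), h0 e (by omega)]

theorem weight_eq_iff {l m : List ℕ} (h : l.length = 5) (hs : l.sum = 16) (h' : m.length = 5)
    (hs' : m.sum = 16) :
    weight (toF l) = weight (toF m) ↔ ∀ i < 5, weightAt i l = weightAt i m := by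
  refine ⟨fun e i _ => by rw [← weight_toF h, ← weight_toF h', e], fun e => funext fun i => ?_⟩
  rw [weight_toF h, weight_toF h']
  rcases lt_or_ge i 5 with hi | hi
  · exact e i hi
  · rw [weightAt_eq_zero h hs hi, weightAt_eq_zero h' hs' hi]

theorem eq_or_monoLT_of_key_le {l m : List ℕ} (h : l.length = 5) (hs : l.sum = 16)
    (h' : m.length = 5) (hs' : m.sum = 16) (hk : key l ≤ key m) :
    l = m ∨ MonoLT (toF l) (toF m) := by
  have digit {p q y z b : ℕ} (hy : y < b) (hz : z < b) (h : b * p + y ≤ b * q + z) :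
      p ≤ q ∧ (p = q → y ≤ z) := by
    refine ⟨?_, fun e => by subst e; omega⟩
    by_contra hlt
    have : b * (q + 1) ≤ b * p := Nat.mul_le_mul_left b (by omega)
    rw [Nat.mul_add] at this
    omega
  have w := fun i => weightAt_le h i
  have w' := fun i => weightAt_le h' i
  have wlt {i : ℕ} (hi : ∀ j < i, weightAt j l = weightAt j m) (hlt : weightAt i l < weightAt i m) :
      MonoLT (toF l) (toF m) := by
    refine Or.inl ⟨i, fun j hj => ?_, ?_⟩
    · change weight (toF l) j = weight (toF m) j
      rw [weight_toF h, weight_toF h', hi j hj]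
    · change weight (toF l) i < weight (toF m) i
      rwa [weight_toF h, weight_toF h']
  have weq := weight_eq_iff h hs h' hs'
  have wcases : MonoLT (toF l) (toF m) ∨ ∀ i < 5, weightAt i l = weightAt i m := by
    have hk := hk
    obtain ⟨a, b, c, d, e, rfl⟩ := exists_list_of_length_five h
    obtain ⟨a', b', c', d', e', rfl⟩ := exists_list_of_length_five h'
    simp only [List.sum_cons, List.sum_nil] at hs hs'
    simp only [key, weightKey, List.foldl_cons, List.foldl_nil, Nat.add_eq, Nat.mul_eq] at hk
    generalize [a, b, c, d, e] = l at *
    generalize [a', b', c', d', e'] = m at *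
    have hk := (digit (by omega) (by omega) hk).1
    have hk := (digit (by omega) (by omega) hk).1
    have hk := (digit (by omega) (by omega) hk).1
    have hk := (digit (by omega) (by omega) hk).1
    have hk := (digit (by omega) (by omega) hk).1
    have hlt : ∀ i, weightAt i l < 8 := fun i => (w i).trans_lt (by norm_num)
    have hlt' : ∀ i, weightAt i m < 8 := fun i => (w' i).trans_lt (by norm_num)
    rw [add_comm, add_comm (weightAt 4 m)] at hk
    obtain ⟨hk, h4⟩ := digit (hlt 4) (hlt' 4) hk
    rw [add_comm, add_comm (weightAt 3 m)] at hk
    obtain ⟨hk, h3⟩ := digit (hlt 3) (hlt' 3) hk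
    rw [add_comm, add_comm (weightAt 2 m)] at hk
    obtain ⟨hk, h2⟩ := digit (hlt 2) (hlt' 2) hk
    rw [add_comm, add_comm (weightAt 1 m)] at hk
    obtain ⟨hk, h1⟩ := digit (hlt 1) (hlt' 1) hk
    by_cases e0 : weightAt 0 l = weightAt 0 m
    swap; · exact Or.inl (wlt (i := 0) (by omega) (by omega))
    have h1 := h1 e0
    by_cases e1 : weightAt 1 l = weightAt 1 m
    swap; · exact Or.inl (wlt (i := 1) (by intro j hj; interval_cases j; assumption) (by omega))
    have h2 := h2 (by omega)
    by_cases e2 : weightAt 2 l = weightAt 2 m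
    swap; · exact Or.inl (wlt (i := 2) (by intro j hj; interval_cases j <;> assumption) (by omega))
    have h3 := h3 (by omega)
    by_cases e3 : weightAt 3 l = weightAt 3 m
    swap; · exact Or.inl (wlt (i := 3) (by intro j hj; interval_cases j <;> assumption) (by omega))
    have h4 := h4 (by omega)
    by_cases e4 : weightAt 4 l = weightAt 4 m
    swap; · exact Or.inl (wlt (i := 4) (by intro j hj; interval_cases j <;> assumption) (by omega))
    exact Or.inr (by intro j hj; interval_cases j <;> assumption)
  rcases wcases with hw | hw
  · exact Or.inr hw
  have hw' := weq.2 hw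
  obtain ⟨a, b, c, d, e, rfl⟩ := exists_list_of_length_five h
  obtain ⟨a', b', c', d', e', rfl⟩ := exists_list_of_length_five h'
  simp only [List.sum_cons, List.sum_nil] at hs hs'
  simp only [key, weightKey, List.foldl_cons, List.foldl_nil, Nat.add_eq, Nat.mul_eq] at hk
  rw [hw 0 (by norm_num), hw 1 (by norm_num), hw 2 (by norm_num), hw 3 (by norm_num),
    hw 4 (by norm_num)] at hk
  obtain ⟨hk, h4⟩ := digit (by omega) (by omega) hk
  obtain ⟨hk, h3⟩ := digit (by omega) (by omega) hk
  obtain ⟨hk, h2⟩ := digit (by omega) (by omega) hk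
  obtain ⟨hk, h1⟩ := digit (by omega) (by omega) hk
  obtain ⟨-, h0⟩ := digit (by omega) (by omega) hk
  have lex (i : Fin 5) (he : ∀ j < i, [a, b, c, d, e].getD j 0 = [a', b', c', d', e'].getD j 0)
      (hlt : [a, b, c, d, e].getD i 0 < [a', b', c', d', e'].getD i 0) :
      MonoLT (toF [a, b, c, d, e]) (toF [a', b', c', d', e']) :=
    Or.inr ⟨hw', i, he, hlt⟩
  have h0 := h0 rfl
  by_cases e0 : a = a'
  swap; · exact Or.inr (lex 0 (by simp) (lt_of_le_of_ne h0 e0))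
  subst e0
  have h1 := h1 rfl
  by_cases e1 : b = b'
  swap; · exact Or.inr (lex 1 (fun j hj => by fin_cases j <;> first | rfl | simp at hj)
    (lt_of_le_of_ne h1 e1))
  subst e1
  have h2 := h2 rfl
  by_cases e2 : c = c'
  swap; · exact Or.inr (lex 2 (fun j hj => by fin_cases j <;> first | rfl | simp at hj)
    (lt_of_le_of_ne h2 e2))
  subst e2
  have h3 := h3 rfl
  by_cases e3 : d = d'
  swap; · exact Or.inr (lex 3 (fun j hj => by fin_cases j <;> first | rfl | simp at hj)
    (lt_of_le_of_ne h3 e3))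
  subst e3
  have h4 := h4 rfl
  by_cases e4 : e = e'
  swap; · exact Or.inr (lex 4 (fun j hj => by fin_cases j <;> first | rfl | simp at hj)
    (lt_of_le_of_ne h4 e4))
  subst e4
  exact Or.inl rfl

/-- The exponent vector of support `S` whose positive entries are `l`. -/
def expand : List Bool → List ℕ → List ℕ
  | [], _ => []
  | false :: S, l => 0 :: expand S l
  | true :: _, [] => []
  | true :: S, e :: l => e :: expand S l

/-- The positive entries. -/
def compress (l : List ℕ) : List ℕ := l.filter fun e => decide (0 < e)

theorem compress_cons_of_pos {e : ℕ} (he : 0 < e) (t : List ℕ) :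
    compress (e :: t) = e :: compress t := by simp [compress, he]

theorem expand_compress (t : List ℕ) : expand (supp t) (compress t) = t := by
  induction t with
  | nil => rfl
  | cons e t ih =>
    rcases Nat.eq_zero_or_pos e with rfl | he
    · exact congrArg (0 :: ·) ih
    · rw [show supp (e :: t) = true :: supp t from congrArg (· :: supp t) (decide_eq_true he),
        compress_cons_of_pos he]
      exact congrArg (e :: ·) ih

theorem supp_compress (t : List ℕ) :
    supp (compress t) = List.replicate ((supp t).countP id) true := by
  rw [List.eq_replicate_iff, length_supp, compress, ← List.countP_eq_length_filter, supp,
    List.countP_map]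
  refine ⟨rfl, fun b hb => ?_⟩
  obtain ⟨e, he, rfl⟩ := List.mem_map.1 hb
  exact (List.mem_filter.1 he).2

theorem sum_compress (t : List ℕ) : (compress t).sum = t.sum := by
  induction t with
  | nil => rfl
  | cons e t ih =>
    rcases Nat.eq_zero_or_pos e with rfl | he
    · simpa [compress] using ih
    · rw [compress_cons_of_pos he, List.sum_cons, List.sum_cons, ih]

theorem compress_expand {S : List Bool} {l : List ℕ}
    (h : supp l = List.replicate (S.countP id) true) : compress (expand S l) = l := by
  induction S generalizing l with
  | nil =>
    obtain rfl : l = [] := by simpa [supp] using h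
    rfl
  | cons b S ih =>
    cases b with
    | false =>
      rw [List.countP_cons_of_neg (by simp)] at h
      exact ih h
    | true =>
      rw [List.countP_cons_of_pos rfl] at h
      obtain ⟨e, l, rfl, he, h⟩ := supp_eq_cons h
      rw [expand, compress_cons_of_pos (of_decide_eq_true he)]
      exact congrArg (e :: ·) (ih h)

theorem supp_expand {S : List Bool} {l : List ℕ}
    (h : supp l = List.replicate (S.countP id) true) : supp (expand S l) = S := by
  induction S generalizing l with
  | nil => rfl
  | cons b S ih =>
    cases b with
    | false =>
      rw [List.countP_cons_of_neg (by simp)] at h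
      exact congrArg (false :: ·) (ih h)
    | true =>
      rw [List.countP_cons_of_pos rfl] at h
      obtain ⟨e, l, rfl, he, h⟩ := supp_eq_cons h
      rw [expand, supp, List.map_cons, he]
      exact congrArg (true :: ·) (ih h)

theorem sqTerms_expand {S : List Bool} {l : List ℕ} (h : l.length = S.countP id) (i : ℕ) :
    sqTerms i (expand S l) = (sqTerms i l).map (expand S) := by
  induction S generalizing l i with
  | nil =>
    obtain rfl : l = [] := by simpa using h
    by_cases hi : i = 0 <;> simp [sqTerms, expand, hi]
  | cons b S ih =>
    cases b with
    | false =>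
      rw [List.countP_cons_of_neg (by simp)] at h
      rw [expand, sqTerms, show subs 0 = [0] from rfl]
      simp only [List.flatMap_singleton, zero_le, if_true, Nat.sub_zero, add_zero, ih h,
        List.map_map]
      rfl
    | true =>
      rw [List.countP_cons_of_pos rfl] at h
      cases l with
      | nil => simp at h
      | cons e l =>
        rw [expand, sqTerms, sqTerms, List.map_flatMap]
        congr 1
        ext1 c
        split_ifs
        · rw [ih (by simpa using h), List.map_map, List.map_map]
          rfl
        · rfl

theorem weightAt_cons (i e : ℕ) (t : List ℕ) :
    weightAt i (e :: t) = (e >>> i &&& 1) + weightAt i t := rfl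

theorem weightAt_compress (i : ℕ) (t : List ℕ) : weightAt i (compress t) = weightAt i t := by
  induction t with
  | nil => rfl
  | cons e t ih =>
    rw [weightAt_cons, ← ih]
    rcases Nat.eq_zero_or_pos e with rfl | he
    · simp [compress]
    · rw [compress_cons_of_pos he, weightAt_cons]

theorem foldl_key_le_iff {l m : List ℕ} (hlm : l.length = m.length) (hl : ∀ e ∈ l, e < 32)
    (hm : ∀ e ∈ m, e < 32) (p q : ℕ) :
    l.foldl (fun n e => 32 * n + e) p ≤ m.foldl (fun n e => 32 * n + e) q ↔
      p < q ∨ p = q ∧ l.foldl (fun n e => 32 * n + e) 0 ≤ m.foldl (fun n e => 32 * n + e) 0 := by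
  induction l generalizing m p q with
  | nil =>
    obtain rfl : m = [] := by simpa [eq_comm] using hlm
    simp [le_iff_lt_or_eq]
  | cons x l ih =>
    cases m with
    | nil => simp at hlm
    | cons y m =>
      have hx : x < 32 := hl x (by simp)
      have hy : y < 32 := hm y (by simp)
      have ih := fun p q => ih (m := m) (by simpa using hlm) (fun e he => hl e (by simp [he]))
        (fun e he => hm e (by simp [he])) p q
      rw [List.foldl_cons, List.foldl_cons, List.foldl_cons, List.foldl_cons, ih, ih (32 * 0 + x)]
      generalize (l.foldl (fun n e => 32 * n + e) 0 ≤ m.foldl (fun n e => 32 * n + e) 0) = R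
      by_cases hR : R <;> simp only [hR, and_true, and_false, or_false] <;> omega

theorem foldl_key_expand_le {S : List Bool} {l m : List ℕ} (hlm : l.length = m.length)
    (hl : ∀ e ∈ l, e < 32) (hm : ∀ e ∈ m, e < 32) {p q : ℕ} (hS : l.length = S.countP id)
    (h : l.foldl (fun n e => 32 * n + e) p ≤ m.foldl (fun n e => 32 * n + e) q) :
    (expand S l).foldl (fun n e => 32 * n + e) p ≤
      (expand S m).foldl (fun n e => 32 * n + e) q := by
  induction S generalizing l m p q with
  | nil =>
    obtain rfl : l = [] := by simpa using hS
    obtain rfl : m = [] := by simpa [eq_comm] using hlm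
    exact h
  | cons b S ih =>
    cases b with
    | false =>
      rw [List.countP_cons_of_neg (by simp)] at hS
      refine ih hlm hl hm hS ?_
      rw [foldl_key_le_iff hlm hl hm] at h ⊢
      change 32 * p + 0 < 32 * q + 0 ∨ 32 * p + 0 = 32 * q + 0 ∧ _
      omega
    | true =>
      rw [List.countP_cons_of_pos rfl] at hS
      match l, m, hlm with
      | [], [], _ => simp at hS
      | x :: l, y :: m, hlm =>
        exact ih (by simpa using hlm) (fun e he => hl e (by simp [he]))
          (fun e he => hm e (by simp [he])) (by simpa using hS) h

theorem key_expand_le {S : List Bool} {l m : List ℕ} (hl : IsExponent (S.countP id) l)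
    (hm : IsExponent (S.countP id) m) (h : key l ≤ key m) :
    key (expand S l) ≤ key (expand S m) := by
  have hw {l : List ℕ} (hl : IsExponent (S.countP id) l) :
      weightKey (expand S l) = weightKey l := by
    have (i : ℕ) : weightAt i (expand S l) = weightAt i l := by
      rw [← weightAt_compress, compress_expand hl.1]
    simp only [weightKey, this]
  have h32 {l : List ℕ} (hl : IsExponent (S.countP id) l) : ∀ e ∈ l, e < 32 := fun e he =>
    (List.le_sum_of_mem he).trans_lt (by rw [hl.2]; norm_num)
  rw [key, key, hw hl, hw hm]
  exact foldl_key_expand_le (hl.length.trans hm.length.symm) (h32 hl) (h32 hm) hl.length h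

/-- The exponent vectors of support `S` and sum 16. -/
def IsExponentOn (S : List Bool) (t : List ℕ) : Prop := supp t = S ∧ t.sum = 16

theorem IsExponentOn.length {S : List Bool} (hS : S.length = 5) {t : List ℕ}
    (h : IsExponentOn S t) : t.length = 5 := by rw [← hS, ← h.1, length_supp]

theorem IsExponentOn.compress {S : List Bool} {t : List ℕ} (h : IsExponentOn S t) :
    IsExponent (S.countP id) (compress t) :=
  ⟨by rw [supp_compress, h.1], by rw [sum_compress, h.2]⟩

theorem IsExponentOn.expand_compress {S : List Bool} {t : List ℕ} (h : IsExponentOn S t) :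
    expand S (HitProblem.compress t) = t := by
  rw [← h.1, HitProblem.expand_compress]

theorem IsExponent.expand {S : List Bool} {l : List ℕ} (h : IsExponent (S.countP id) l) :
    IsExponentOn S (expand S l) :=
  ⟨supp_expand h.1, by rw [← sum_compress, compress_expand h.1, h.2]⟩

theorem countP_le_five {S : List Bool} (hS : S.length = 5) : S.countP id ≤ 5 :=
  hS ▸ List.countP_le_length

/-- The admissible exponent vectors of degree 16 and support `S`. -/
def basis (S : List Bool) : List (List ℕ) := (shortBasis (S.countP id)).map (expand S)

theorem isExponentOn_of_mem_basis {S : List Bool} (hS : S.length = 5) {b : List ℕ}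
    (hb : b ∈ basis S) : IsExponentOn S b := by
  obtain ⟨c, hc, rfl⟩ := List.mem_map.1 hb
  exact (isExponent_of_mem_shortBasis (countP_le_five hS) hc).expand

/-- The span of the monomials of support `S`. -/
def PSupp (S : List Bool) : Submodule (ZMod 2) (P 5) :=
  Submodule.span (ZMod 2) {f | ∃ l, supp l = S ∧ f = ml l}

/-- The monomials of support `S` and degree 16 are spanned modulo hits by the basis. -/
theorem ml_mem_span_sup_hit {S : List Bool} (hS : S.length = 5) {t : List ℕ}
    (ht : IsExponentOn S t) :
    ml t ∈ Submodule.span (ZMod 2) {f | ∃ b ∈ basis S, f = ml b} ⊔ hit (PSupp S) := by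
  have hW : ContainsHits (S.countP id) (fun l => ml (expand S l))
      (Submodule.span (ZMod 2) {f | ∃ b ∈ basis S, f = ml b} ⊔ hit (PSupp S)) := by
    intro i f hi hf
    have hl : f.length = S.countP id := by rw [← length_supp, hf, List.length_replicate]
    have hs := supp_expand hf
    have h := Sq_ml (l := expand S f) (by rw [← length_supp, hs, hS]) i
    rw [sqTerms_expand hl, List.map_map] at h
    have hmem : ml (expand S f) ∈ PSupp S := Submodule.subset_span ⟨_, hs, rfl⟩
    exact Submodule.mem_sup_right (h ▸ Sq_mem_hit hmem hi)
  rw [← ht.expand_compress]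
  exact mem_of_containsHits (countP_le_five hS) hW (fun b hb => Submodule.mem_sup_left
    (Submodule.subset_span ⟨_, List.mem_map_of_mem hb, rfl⟩)) ht.compress

theorem exists_table (s : ℕ) : ∃ N : ℕ → ℕ, s ≤ 5 →
    (∀ j (hj : j < (shortBasis s).length), N (code (shortBasis s)[j]) = 2 ^ j) ∧
    (∀ t, IsExponent s t → ∀ j (hj : j < (shortBasis s).length), (N (code t)).testBit j = true →
      key (shortBasis s)[j] ≤ key t) ∧
    (∀ f i, supp f = List.replicate s true → 1 ≤ i → i + f.sum = 16 →
      ((sqTerms i f).map fun t => N (code t)).foldr (· ^^^ ·) 0 = 0) := by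
  obtain ⟨N, hN⟩ := exists_withTable s (basisCodes s) (relationCodes s)
  refine ⟨fun c => N c >>> 64, fun hs => ?_⟩
  have h := List.all_eq_true.1 tableCheck_eq_true s (List.mem_range.2 (by omega))
  rw [tableCheck, hN] at h
  obtain ⟨h1, h2⟩ := (Bool.and_eq_true _ _).mp h
  obtain ⟨h2, h3⟩ := (Bool.and_eq_true _ _).mp h2
  refine ⟨fun j hj => ?_, fun t ht j hj hb => ?_, fun f i hf hi hif => ?_⟩
  · have := diagCheck_spec h1 j (by simpa [shortBasis] using hj)
    simpa [shortBasis] using this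
  · have := orderCheck_spec h2 ht (by simpa [shortBasis] using hj) hb
    simpa [shortBasis] using this
  · have h4 := killCheck_spec h3 hf hi hif
    have shift (L : List (List ℕ)) : (L.map fun t => N (code t) >>> 64).foldr (· ^^^ ·) 0 =
        (L.map fun t => N (code t)).foldr (· ^^^ ·) 0 >>> 64 := by
      induction L with
      | nil => simp
      | cons t L ih => simp only [List.map_cons, List.foldr_cons, ih, Nat.shiftRight_xor_distrib]
    rw [shift, h4]
    rfl

/-- The normal forms of the monomials with `s` variables, as sets of indices of basis
monomials. -/
def shortTable (s : ℕ) : ℕ → ℕ := (exists_table s).choose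

/-- The normal form of a monomial, as a set of indices of basis monomials. -/
def table (t : List ℕ) : ℕ := shortTable ((supp t).countP id) (code (compress t))

theorem table_basis {S : List Bool} (hS : S.length = 5) {j : ℕ} (hj : j < (basis S).length) :
    table (basis S)[j] = 2 ^ j := by
  have hj' : j < (shortBasis (S.countP id)).length := by simpa [basis] using hj
  have hs := countP_le_five hS
  have he := isExponent_of_mem_shortBasis hs (List.getElem_mem hj')
  simp only [basis, List.getElem_map]
  rw [table, supp_expand he.1, compress_expand he.1]
  exact ((exists_table _).choose_spec hs).1 j hj'

theorem key_le_of_testBit_table {S : List Bool} (hS : S.length = 5) {t : List ℕ}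
    (ht : IsExponentOn S t) {j : ℕ} (hj : j < (basis S).length)
    (h : (table t).testBit j = true) : key (basis S)[j] ≤ key t := by
  have hj' : j < (shortBasis (S.countP id)).length := by simpa [basis] using hj
  have hs := countP_le_five hS
  have he := isExponent_of_mem_shortBasis hs (List.getElem_mem hj')
  rw [table, ht.1] at h
  have hk := ((exists_table _).choose_spec hs).2.1 _ ht.compress j hj' h
  simpa only [basis, List.getElem_map, ht.expand_compress] using key_expand_le he ht.compress hk

theorem foldr_xor_table {f : List ℕ} (hf : f.length = 5) {i : ℕ} (hi : 1 ≤ i)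
    (hif : i + f.sum = 16) : ((sqTerms i f).map table).foldr (· ^^^ ·) 0 = 0 := by
  have hs : (supp f).countP id ≤ 5 := countP_le_five (by rw [length_supp, hf])
  have hc := supp_compress f
  have h := ((exists_table _).choose_spec hs).2.2 (compress f) i hc hi (by rwa [sum_compress])
  have he := sqTerms_expand (S := supp f) (l := compress f)
    (by rw [← length_supp, hc, List.length_replicate]) i
  rw [expand_compress] at he
  rw [he, List.map_map, ← h]
  congr 1
  refine List.map_congr_left fun t ht => ?_
  have ht : supp t = List.replicate ((supp f).countP id) true := hc ▸ (mem_sqTerms ht).1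
  rw [Function.comp_apply, table, supp_expand ht, compress_expand ht]
  rfl

/-- The sum of the basis monomials whose indices are the binary digits of `n`. -/
def sumBits (S : List Bool) (n : ℕ) : P 5 :=
  ∑ j : Fin (basis S).length, if n.testBit j then ml (basis S)[j] else 0

theorem sumBits_zero (S : List Bool) : sumBits S 0 = 0 := by simp [sumBits]

theorem sumBits_xor (S : List Bool) (m n : ℕ) :
    sumBits S (m ^^^ n) = sumBits S m + sumBits S n := by
  rw [sumBits, sumBits, sumBits, ← Finset.sum_add_distrib]
  refine Finset.sum_congr rfl fun j _ => ?_
  rw [Nat.testBit_xor]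
  cases m.testBit j <;> cases n.testBit j <;> simp [CharTwo.add_self_eq_zero]

theorem sumBits_two_pow (S : List Bool) {j : ℕ} (hj : j < (basis S).length) :
    sumBits S (2 ^ j) = ml (basis S)[j] := by
  rw [sumBits, Finset.sum_eq_single ⟨j, hj⟩]
  · simp
  · intro i _ hi
    have : ¬ j = i := fun h => hi (Fin.ext h.symm)
    simp [this]
  · simp

theorem ofFn_toF {t : List ℕ} (h : t.length = 5) : List.ofFn (toF t) = t := by
  obtain ⟨a, b, c, d, e, rfl⟩ := exists_list_of_length_five h
  rfl

theorem degree_toF {t : List ℕ} (h : t.length = 5) : (toF t).degree = t.sum := by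
  obtain ⟨a, b, c, d, e, rfl⟩ := exists_list_of_length_five h
  rw [Finsupp.degree_eq_sum, Fin.sum_univ_five]
  simp [toF, add_assoc]

/-- The normal form modulo hit polynomials in degree 16 (and zero in the other degrees). -/
def normalForm : P 5 →ₗ[ZMod 2] P 5 :=
  (basisMonomials (Fin 5) (ZMod 2)).constr (ZMod 2) fun a =>
    if a.degree = 16 then
      sumBits (supp (List.ofFn a)) (table (List.ofFn a)) else 0

theorem normalForm_ml {t : List ℕ} (h : t.length = 5) :
    normalForm (ml t) = if t.sum = 16 then sumBits (supp t) (table t) else 0 := by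
  have := (basisMonomials (Fin 5) (ZMod 2)).constr_basis (ZMod 2) (fun a =>
    if a.degree = 16 then
      sumBits (supp (List.ofFn a)) (table (List.ofFn a)) else 0) (toF t)
  rw [ofFn_toF h, degree_toF h, coe_basisMonomials] at this
  exact this

theorem normalForm_basis {S : List Bool} (hS : S.length = 5) {b : List ℕ} (hb : b ∈ basis S) :
    normalForm (ml b) = ml b := by
  have he := isExponentOn_of_mem_basis hS hb
  obtain ⟨j, hj, rfl⟩ := List.getElem_of_mem hb
  rw [normalForm_ml (he.length hS), if_pos he.2, he.1, table_basis hS hj, sumBits_two_pow]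

theorem normalForm_Sq {i : ℕ} (hi : 1 ≤ i) (f : P 5) : normalForm (Sq i 5 f) = 0 := by
  suffices normalForm ∘ₗ Sq i 5 = 0 from LinearMap.congr_fun this f
  refine (basisMonomials (Fin 5) (ZMod 2)).ext fun a => ?_
  have ha : (basisMonomials (Fin 5) (ZMod 2)) a = ml (List.ofFn a) := by
    rw [ml, toF_ofFn, coe_basisMonomials, mono]
  have hl : (List.ofFn a).length = 5 := by simp
  rw [ha, LinearMap.comp_apply, Sq_ml hl, map_list_sum, List.map_map, LinearMap.zero_apply]
  generalize List.ofFn a = l at hl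
  by_cases hd : i + l.sum = 16
  · have h1 : (sqTerms i l).map (normalForm ∘ ml) =
        (sqTerms i l).map fun t => sumBits (supp l) (table t) := by
      refine List.map_congr_left fun t ht => ?_
      obtain ⟨h2, h3⟩ := mem_sqTerms ht
      have h2 : supp t = supp l := h2
      have h4 : t.length = 5 := by rw [← length_supp, h2, length_supp, hl]
      rw [Function.comp_apply, normalForm_ml h4, if_pos (h3.trans hd), h2]
    have h5 (L : List (List ℕ)) (g : List ℕ → ℕ) : (L.map fun t => sumBits (supp l) (g t)).sum =
        sumBits (supp l) ((L.map g).foldr (· ^^^ ·) 0) := by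
      induction L with
      | nil => simp [sumBits_zero]
      | cons t L ih => simp [ih, sumBits_xor]
    rw [h1, h5, foldr_xor_table hl hi hd, sumBits_zero]
  · refine List.sum_eq_zero fun x hx => ?_
    obtain ⟨t, ht, rfl⟩ := List.mem_map.1 hx
    obtain ⟨h2, h3⟩ := mem_sqTerms ht
    have h4 : t.length = 5 := by simpa [hl] using congrArg List.length h2
    rw [Function.comp_apply, normalForm_ml h4, if_neg (h3 ▸ hd)]

theorem hit_le_ker_normalForm (M : Submodule (ZMod 2) (P 5)) :
    hit M ≤ LinearMap.ker normalForm :=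
  hit_le_ker _ (fun _ hi => normalForm_Sq hi) M

theorem sub_normalForm_mem_hit {S : List Bool} (hS : S.length = 5) {t : List ℕ}
    (ht : IsExponentOn S t) : ml t - normalForm (ml t) ∈ hit (PSupp S) := by
  obtain ⟨u, hu, v, hv, e⟩ := Submodule.mem_sup.1 (ml_mem_span_sup_hit hS ht)
  have hu' : normalForm u = u := by
    have : Submodule.span (ZMod 2) {f | ∃ b ∈ basis S, f = ml b} ≤
        LinearMap.eqLocus normalForm LinearMap.id := by
      rw [Submodule.span_le]
      rintro _ ⟨b, hb, rfl⟩
      exact normalForm_basis hS hb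
    exact this hu
  rw [← e, map_add, hu', hit_le_ker_normalForm _ hv, add_zero, add_sub_cancel_left]
  exact hv

/-- The basis monomials of degree 16. -/
def IsBasis (a : Fin 5 →₀ ℕ) : Prop := List.ofFn a ∈ basis (supp (List.ofFn a))

theorem length_supp_ofFn (a : Fin 5 →₀ ℕ) : (supp (List.ofFn a)).length = 5 := by
  simp [supp]

theorem mono_eq_ml (a : Fin 5 →₀ ℕ) : mono a = ml (List.ofFn a) := by rw [ml, toF_ofFn]

theorem sum_ofFn (a : Fin 5 →₀ ℕ) : (List.ofFn a).sum = a.degree := by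
  rw [← degree_toF (by simp), toF_ofFn]

theorem isBasis_toF {S : List Bool} (hS : S.length = 5) {b : List ℕ} (hb : b ∈ basis S) :
    IsBasis (toF b) := by
  have he := isExponentOn_of_mem_basis hS hb
  rwa [IsBasis, ofFn_toF (he.length hS), he.1]

theorem IsBasis.degree_eq {a : Fin 5 →₀ ℕ} (h : IsBasis a) : a.degree = 16 := by
  rw [← sum_ofFn]
  exact (isExponentOn_of_mem_basis (length_supp_ofFn a) h).2

theorem IsBasis.normalForm_mono {a : Fin 5 →₀ ℕ} (h : IsBasis a) :
    normalForm (mono a) = mono a := by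
  rw [mono_eq_ml]
  exact normalForm_basis (length_supp_ofFn a) h

theorem mono_sub_normalForm_mem_hit {a : Fin 5 →₀ ℕ} (h : a.degree = 16) :
    mono a - normalForm (mono a) ∈ hit (PSupp (supp (List.ofFn a))) := by
  rw [mono_eq_ml]
  exact sub_normalForm_mem_hit (length_supp_ofFn a) ⟨rfl, (sum_ofFn a).trans h⟩

theorem exists_normalForm_eq_sum {a : Fin 5 →₀ ℕ} (h : a.degree = 16) :
    ∃ L : List (Fin 5 →₀ ℕ), (∀ b ∈ L, IsBasis b ∧ supp (List.ofFn b) = supp (List.ofFn a) ∧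
      (b = a ∨ MonoLT b a)) ∧ normalForm (mono a) = (L.map mono).sum := by
  have hS := length_supp_ofFn a
  have ha : IsExponentOn (supp (List.ofFn a)) (List.ofFn a) := ⟨rfl, (sum_ofFn a).trans h⟩
  generalize hS' : supp (List.ofFn a) = S at hS ha
  let s := Finset.univ.filter fun j : Fin (basis S).length =>
    (table (List.ofFn a)).testBit j = true
  refine ⟨s.toList.map fun j => toF (basis S)[j], fun b hb => ?_, ?_⟩
  · obtain ⟨j, hj, rfl⟩ := List.mem_map.1 hb
    have hj : (table (List.ofFn a)).testBit j = true := by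
      simpa [s] using hj
    have hmem : (basis S)[j] ∈ basis S := List.getElem_mem _
    have he := isExponentOn_of_mem_basis hS hmem
    refine ⟨isBasis_toF hS hmem, ?_, ?_⟩
    · rw [ofFn_toF (he.length hS), he.1]
    · have hk := key_le_of_testBit_table hS ha j.2 hj
      rcases eq_or_monoLT_of_key_le (he.length hS) he.2 (ha.length hS) ha.2 hk with h | h
      · exact Or.inl ((congrArg toF h).trans (toF_ofFn a))
      · rw [toF_ofFn] at h
        exact Or.inr h
  · rw [mono_eq_ml, normalForm_ml (ha.length hS), if_pos ha.2, ha.1, sumBits, ← Finset.sum_filter,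
      List.map_map, Finset.sum_map_toList]
    rfl

theorem MonoLT.irrefl (a : Fin 5 →₀ ℕ) : ¬ MonoLT a a := by
  rintro (h | ⟨_, h⟩) <;> exact lt_irrefl _ h

theorem MonoLT.asymm {a b : Fin 5 →₀ ℕ} (h : MonoLT a b) : ¬ MonoLT b a := by
  rintro (h' | ⟨e', h'⟩) <;> rcases h with h | ⟨e, h⟩
  · exact lt_asymm h h'
  · rw [e] at h'; exact lt_irrefl _ h'
  · rw [e'] at h; exact lt_irrefl _ h
  · exact lt_asymm h h'

theorem coeff_mono (a b : Fin 5 →₀ ℕ) : coeff a (mono b) = if b = a then 1 else 0 := by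
  simp [mono, coeff_monomial]

theorem IsBasis.not_inadmissible {a : Fin 5 →₀ ℕ} (h : IsBasis a) : ¬ Inadmissible a := by
  rintro ⟨t, b, hb, hmem⟩
  have h0 : normalForm (mono a + ∑ j, mono (b j)) = 0 := hit_le_ker_normalForm _ hmem
  rw [map_add, h.normalForm_mono, map_sum] at h0
  have hj (j : Fin t) : coeff a (normalForm (mono (b j))) = 0 := by
    obtain ⟨L, hL, e⟩ := exists_normalForm_eq_sum ((hb j).1.trans h.degree_eq)
    rw [e, ← lcoeff_apply (R := ZMod 2), map_list_sum, List.map_map]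
    refine List.sum_eq_zero fun x hx => ?_
    obtain ⟨c, hc, rfl⟩ := List.mem_map.1 hx
    rw [Function.comp_apply, lcoeff_apply, coeff_mono, if_neg]
    rintro rfl
    rcases (hL c hc).2.2 with h | h
    · exact MonoLT.irrefl _ (h ▸ (hb j).2)
    · exact h.asymm (hb j).2
  have h1 := congrArg (coeff a) h0
  rw [coeff_add, coeff_sum, Finset.sum_eq_zero fun j _ => hj j, coeff_mono, if_pos rfl] at h1
  simp at h1

theorem inadmissible_of_not_isBasis {a : Fin 5 →₀ ℕ} (ha : a.degree = 16) (h : ¬ IsBasis a) :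
    Inadmissible a := by
  obtain ⟨L, hL, e⟩ := exists_normalForm_eq_sum ha
  refine ⟨L.length, fun j => L[j], fun j => ?_, ?_⟩
  · obtain ⟨h1, _, h2⟩ := hL L[j] (List.getElem_mem _)
    refine ⟨h1.degree_eq.trans ha.symm, h2.resolve_left fun e => h (e ▸ h1)⟩
  · have h1 : ∑ j : Fin L.length, mono L[j] = normalForm (mono a) := by
      rw [e, ← List.sum_ofFn]
      congr 1
      simp [List.ofFn_getElem_eq_map]
    rw [h1, ← CharTwo.sub_eq_add]
    exact hit_mono le_top (mono_sub_normalForm_mem_hit ha)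

theorem mem_B_iff {a : Fin 5 →₀ ℕ} : a ∈ B 5 16 ↔ IsBasis a :=
  ⟨fun h => by_contra fun h' => h.2 (inadmissible_of_not_isBasis h.1 h'),
    fun h => ⟨h.degree_eq, h.not_inadmissible⟩⟩

theorem mem_of_mem_support {D : (Fin 5 →₀ ℕ) → Prop} {f : P 5}
    (hf : f ∈ Submodule.span (ZMod 2) {f : P 5 | ∃ a, D a ∧ f = mono a}) :
    ∀ a ∈ f.support, D a := by
  induction hf using Submodule.span_induction with
  | mem f hf =>
    obtain ⟨a, ha, rfl⟩ := hf
    intro b hb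
    rw [mem_support_iff, coeff_mono] at hb
    obtain rfl : a = b := by by_contra h; simp [h] at hb
    exact ha
  | zero => simp
  | add f g _ _ hf hg =>
    intro a ha
    rcases Finset.mem_union.1 (support_add ha) with h | h
    · exact hf a h
    · exact hg a h
  | smul c f _ hf => exact fun a ha => hf a (support_smul ha)

theorem linearIndepOn_mkQ_mono (M : Submodule (ZMod 2) (P 5)) :
    LinearIndepOn (ZMod 2) ((hit M).mkQ ∘ mono) {a | IsBasis a} := by
  let φ := (hit M).liftQ normalForm (hit_le_ker_normalForm M)
  have h1 : LinearIndepOn (ZMod 2) (mono : (Fin 5 →₀ ℕ) → P 5) {a | IsBasis a} := by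
    have := (basisMonomials (Fin 5) (ZMod 2)).linearIndependent
    rw [coe_basisMonomials] at this
    exact this.linearIndepOn _
  have h2 : LinearIndepOn (ZMod 2) (φ ∘ ((hit M).mkQ ∘ mono)) {a | IsBasis a} :=
    h1.congr fun a ha => by
      simp only [Function.comp_apply, φ, Submodule.mkQ_apply, Submodule.liftQ_apply]
      exact (IsBasis.normalForm_mono ha).symm
  exact LinearIndependent.of_comp φ h2

theorem Q_eq_span {D : (Fin 5 →₀ ℕ) → Prop}
    (hD : ∀ a b : Fin 5 →₀ ℕ, supp (List.ofFn a) = supp (List.ofFn b) → D a → D b)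
    {M : Submodule (ZMod 2) (P 5)}
    (hM : M = Submodule.span (ZMod 2) {f : P 5 | ∃ a, D a ∧ f = mono a}) :
    Q M 16 = Submodule.span (ZMod 2) (((hit M).mkQ ∘ mono) '' {a | IsBasis a ∧ D a}) := by
  have hmono {a} (ha : D a) : mono a ∈ M := by
    rw [hM]; exact Submodule.subset_span ⟨a, ha, rfl⟩
  have hP {a} (ha : D a) : PSupp (supp (List.ofFn a)) ≤ M := by
    rw [PSupp, Submodule.span_le]
    rintro _ ⟨l, hl, rfl⟩
    have h5 : l.length = 5 := by rw [← length_supp, hl, length_supp_ofFn]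
    exact hmono (hD a _ (by rw [ofFn_toF h5, hl]) ha)
  apply le_antisymm
  · rintro _ ⟨f, ⟨hf, hdeg⟩, rfl⟩
    have hdeg : f.IsHomogeneous 16 := hdeg
    rw [f.as_sum, map_sum]
    refine Submodule.sum_mem _ fun a ha => ?_
    have ha16 : a.degree = 16 := by
      rw [Finsupp.degree_eq_weight_one]
      exact hdeg (mem_support_iff.1 ha)
    have haD : D a := mem_of_mem_support (hM ▸ hf) a ha
    have hz : ∀ z : ZMod 2, z ≠ 0 → z = 1 := by decide
    have hc : coeff a f = 1 := hz _ (mem_support_iff.1 ha)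
    rw [hc]
    obtain ⟨L, hL, e⟩ := exists_normalForm_eq_sum ha16
    have h1 : (hit M).mkQ (mono a) = (hit M).mkQ (normalForm (mono a)) := by
      rw [← sub_eq_zero, ← map_sub]
      exact (Submodule.Quotient.mk_eq_zero _).2
        (hit_mono (hP haD) (mono_sub_normalForm_mem_hit ha16))
    rw [← mono, h1, e, map_list_sum, List.map_map]
    refine list_sum_mem fun x hx => ?_
    obtain ⟨b, hb, rfl⟩ := List.mem_map.1 hx
    obtain ⟨h2, h3, -⟩ := hL b hb
    exact Submodule.subset_span ⟨b, ⟨h2, hD a b h3.symm haD⟩, rfl⟩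
  · rw [Submodule.span_le]
    rintro _ ⟨a, ⟨ha, haD⟩, rfl⟩
    refine ⟨mono a, ⟨hmono haD, ?_⟩, rfl⟩
    exact isHomogeneous_monomial _ ha.degree_eq

theorem finrank_Q {D : (Fin 5 →₀ ℕ) → Prop}
    (hD : ∀ a b : Fin 5 →₀ ℕ, supp (List.ofFn a) = supp (List.ofFn b) → D a → D b)
    {M : Submodule (ZMod 2) (P 5)}
    (hM : M = Submodule.span (ZMod 2) {f : P 5 | ∃ a, D a ∧ f = mono a})
    (hfin : {a | IsBasis a ∧ D a}.Finite) :
    Module.finrank (ZMod 2) (Q M 16) = {a | IsBasis a ∧ D a}.ncard := by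
  have := hfin.fintype
  have h1 : LinearIndepOn (ZMod 2) ((hit M).mkQ ∘ mono) {a | IsBasis a ∧ D a} :=
    (linearIndepOn_mkQ_mono M).mono fun a ha => ha.1
  have h2 := finrank_span_eq_card h1
  rw [Q_eq_span hD hM, ← Nat.card_coe_set_eq, Nat.card_eq_fintype_card, ← h2, Set.image_eq_range]

def fullSupport : List Bool := [true, true, true, true, true]

/-- The lists of `n` Booleans. -/
def supports (n : ℕ) : List (List Bool) :=
  Nat.rec (motive := fun _ => List (List Bool)) [[]]
    (fun _ L => L.map (List.cons false) ++ L.map (List.cons true)) n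

/-- The basis exponent vectors in which some entry is zero. -/
def zeroBasis : List (List ℕ) :=
  ((supports 5).filter fun S => !S.all id).flatMap basis

theorem nodup_code_zeroBasis : (zeroBasis.map code).Nodup := by decide +kernel

theorem length_zeroBasis : zeroBasis.length = 255 := by decide +kernel

theorem nodup_code_fullBasis : ((basis fullSupport).map code).Nodup := by decide +kernel

theorem basis_perm_aList : (basis fullSupport).Perm (aList.map List.ofFn) :=
  List.isPerm_iff.1 (by decide +kernel)

/-- The number of exponents with binary digit `1` in each of the first five places. -/
def weightList (l : List ℕ) : List ℕ := (List.range 5).map fun i => weightAt i l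

theorem weightList_aList : aList.map (fun v => weightList (List.ofFn v)) =
    List.replicate 4 [2, 1, 1, 1, 0] ++ List.replicate 5 [2, 1, 3, 0, 0] ++
      List.replicate 20 [2, 3, 2, 0, 0] ++ List.replicate 110 [4, 2, 2, 0, 0] ++
        List.replicate 49 [4, 4, 1, 0, 0] := by
  decide +kernel

theorem length_aList : aList.length = 188 := by decide +kernel

theorem mem_supports {S : List Bool} {n : ℕ} (h : S.length = n) : S ∈ supports n := by
  induction n generalizing S with
  | zero => simpa [supports] using h
  | succ n ih =>
    cases S with
    | nil => simp at h
    | cons b S =>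
      have := ih (by simpa using h)
      rw [show supports (n + 1) = (supports n).map (List.cons false) ++
        (supports n).map (List.cons true) from rfl]
      cases b <;> simp [this]

theorem length_of_mem_supports {S : List Bool} {n : ℕ} (h : S ∈ supports n) : S.length = n := by
  induction n generalizing S with
  | zero => simpa [supports] using h
  | succ n ih =>
    rw [show supports (n + 1) = (supports n).map (List.cons false) ++
      (supports n).map (List.cons true) from rfl] at h
    rcases List.mem_append.1 h with h | h <;> obtain ⟨T, hT, rfl⟩ := List.mem_map.1 h <;>
      simp [ih hT]

theorem eq_fullSupport_iff {S : List Bool} (hS : S.length = 5) :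
    S = fullSupport ↔ S.all id = true := by
  obtain ⟨a, b, c, d, e, rfl⟩ := exists_list_of_length_five hS
  simp [fullSupport]

theorem prod_pos_iff (a : Fin 5 →₀ ℕ) : 0 < ∏ j, a j ↔ supp (List.ofFn a) = fullSupport := by
  simp [supp, fullSupport, Fin.prod_univ_five, and_assoc]

theorem isBasis_and_prod_pos_iff {a : Fin 5 →₀ ℕ} :
    IsBasis a ∧ 0 < ∏ j, a j ↔ List.ofFn a ∈ basis fullSupport := by
  rw [prod_pos_iff]
  refine ⟨fun ⟨h, e⟩ => e ▸ h, fun h => ?_⟩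
  have e := (isExponentOn_of_mem_basis rfl h).1
  exact ⟨by rwa [IsBasis, e], e⟩

theorem isBasis_and_prod_eq_zero_iff {a : Fin 5 →₀ ℕ} :
    IsBasis a ∧ ∏ j, a j = 0 ↔ List.ofFn a ∈ zeroBasis := by
  have h0 {S : List Bool} (hS : S.length = 5) : S ∈ (supports 5).filter (fun S => !S.all id) ↔
      S ≠ fullSupport := by
    rw [List.mem_filter, Ne, eq_fullSupport_iff hS]
    simp [mem_supports hS]
  have h1 : ∏ j, a j = 0 ↔ supp (List.ofFn a) ≠ fullSupport := by
    rw [Ne, ← prod_pos_iff]; omega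
  rw [h1, ← h0 (length_supp_ofFn a), zeroBasis, List.mem_flatMap]
  refine ⟨fun ⟨h, h'⟩ => ⟨_, h', h⟩, fun ⟨S, hS, h⟩ => ?_⟩
  have e := (isExponentOn_of_mem_basis (length_of_mem_supports (List.mem_filter.1 hS).1) h).1
  subst e
  exact ⟨h, hS⟩

theorem ncard_setOf_ofFn_mem {L : List (List ℕ)} (h5 : ∀ l ∈ L, l.length = 5)
    (hL : (L.map code).Nodup) :
    {a : Fin 5 →₀ ℕ | List.ofFn a ∈ L}.Finite ∧
      {a : Fin 5 →₀ ℕ | List.ofFn a ∈ L}.ncard = L.length := by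
  classical
  have h1 : {a : Fin 5 →₀ ℕ | List.ofFn a ∈ L} = ↑(L.map toF).toFinset := by
    ext a
    simp only [Set.mem_ofPred_eq, List.coe_toFinset, List.mem_map]
    refine ⟨fun h => ⟨_, h, toF_ofFn a⟩, ?_⟩
    rintro ⟨l, hl, rfl⟩
    rwa [ofFn_toF (h5 l hl)]
  have h2 : (L.map toF).Nodup := hL.of_map.map_on fun l hl m hm e => by
    rw [← ofFn_toF (h5 l hl), e, ofFn_toF (h5 m hm)]
  rw [h1, Set.ncard_coe_finset, List.toFinset_card_of_nodup h2, List.length_map]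
  exact ⟨Finset.finite_toSet _, rfl⟩

theorem ncard_fullBasis : {a : Fin 5 →₀ ℕ | IsBasis a ∧ 0 < ∏ j, a j}.Finite ∧
    {a : Fin 5 →₀ ℕ | IsBasis a ∧ 0 < ∏ j, a j}.ncard = 188 := by
  simp only [isBasis_and_prod_pos_iff]
  have h := ncard_setOf_ofFn_mem
    (fun l hl => (isExponentOn_of_mem_basis rfl hl).length rfl) nodup_code_fullBasis
  rwa [basis_perm_aList.length_eq, List.length_map, length_aList] at h

theorem ncard_zeroBasis : {a : Fin 5 →₀ ℕ | IsBasis a ∧ ∏ j, a j = 0}.Finite ∧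
    {a : Fin 5 →₀ ℕ | IsBasis a ∧ ∏ j, a j = 0}.ncard = 255 := by
  simp only [isBasis_and_prod_eq_zero_iff]
  rw [← length_zeroBasis]
  refine ncard_setOf_ofFn_mem (fun l hl => ?_) nodup_code_zeroBasis
  obtain ⟨S, hS, hl⟩ := List.mem_flatMap.1 hl
  have hS := length_of_mem_supports (List.mem_filter.1 hS).1
  exact (isExponentOn_of_mem_basis hS hl).length hS

theorem ncard_basis : {a : Fin 5 →₀ ℕ | IsBasis a}.Finite ∧
    {a : Fin 5 →₀ ℕ | IsBasis a}.ncard = 443 := by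
  have h : {a : Fin 5 →₀ ℕ | IsBasis a} =
      {a | IsBasis a ∧ 0 < ∏ j, a j} ∪ {a | IsBasis a ∧ ∏ j, a j = 0} := by
    ext a
    simp only [Set.mem_union, Set.mem_ofPred_eq, ← and_or_left, Nat.eq_zero_or_pos, or_comm,
      and_true]
  rw [h]
  refine ⟨ncard_fullBasis.1.union ncard_zeroBasis.1, ?_⟩
  rw [Set.ncard_union_eq _ ncard_fullBasis.1 ncard_zeroBasis.1,
    ncard_fullBasis.2, ncard_zeroBasis.2]
  rw [Set.disjoint_left]
  rintro a ⟨_, h⟩ ⟨_, h'⟩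
  omega

theorem ofFn_a {t : ℕ} (ht : t ∈ Set.Icc 1 188) :
    List.ofFn (a t) = (aList.map List.ofFn)[t - 1]'(by
      rw [List.length_map, length_aList]; have := ht.1; have := ht.2; omega) := by
  have : t - 1 < aList.length := by rw [length_aList]; have := ht.1; have := ht.2; omega
  rw [List.getElem_map, a, List.getD_eq_getElem _ _ this]
  rfl

theorem injOn_a : Set.InjOn a (Set.Icc 1 188) := by
  intro s hs t ht e
  have hn : (aList.map List.ofFn).Nodup := basis_perm_aList.nodup_iff.1 nodup_code_fullBasis.of_map
  have h := congrArg (fun b : Fin 5 →₀ ℕ => List.ofFn b) e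
  rw [ofFn_a hs, ofFn_a ht, hn.getElem_inj_iff] at h
  have := hs.1
  have := ht.1
  omega

theorem image_a : a '' Set.Icc 1 188 = {b | IsBasis b ∧ 0 < ∏ j, b j} := by
  ext b
  rw [Set.mem_ofPred_eq, isBasis_and_prod_pos_iff, basis_perm_aList.mem_iff]
  constructor
  · rintro ⟨t, ht, rfl⟩
    rw [ofFn_a ht]
    exact List.getElem_mem _
  · intro h
    obtain ⟨i, hi, e⟩ := List.getElem_of_mem h
    have hi' : i < 188 := by rwa [List.length_map, length_aList] at hi
    have ht : i + 1 ∈ Set.Icc 1 188 := ⟨by omega, by omega⟩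
    refine ⟨i + 1, ht, ?_⟩
    rw [← toF_ofFn (a (i + 1)), ← toF_ofFn b, ofFn_a ht, ← e]
    rfl

theorem mem_BPlus_iff {b : Fin 5 →₀ ℕ} : b ∈ BPlus 5 16 ↔ IsBasis b ∧ 0 < ∏ j, b j := by
  refine and_congr mem_B_iff ⟨fun h => ?_, fun h => Submodule.subset_span ⟨b, h, rfl⟩⟩
  exact mem_of_mem_support (D := fun b => 0 < ∏ j, b j) h b (by
    rw [mem_support_iff, coeff_mono, if_pos rfl]; exact one_ne_zero)

theorem BPlus_eq : BPlus 5 16 = a '' Set.Icc 1 188 := by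
  rw [image_a]
  ext b
  exact mem_BPlus_iff

theorem weight_eq_weightVec_iff {b : Fin 5 →₀ ℕ} (hb : b.degree = 16) {ω : List ℕ}
    (hω : ω.length ≤ 5) :
    weight b = weightVec ω ↔ weightList (List.ofFn b) = (List.range 5).map fun i => ω.getD i 0 := by
  have h5 : (List.ofFn b).length = 5 := by simp
  have hw (i : ℕ) : weight b i = weightAt i (List.ofFn b) := by rw [← weight_toF h5, toF_ofFn]
  rw [weightList, List.map_inj_left]
  refine ⟨fun h i _ => by rw [← hw, h]; rfl, fun h => funext fun i => ?_⟩
  rw [hw]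
  rcases lt_or_ge i 5 with hi | hi
  · exact h i (List.mem_range.2 hi)
  · rw [weightAt_eq_zero h5 ((sum_ofFn b).trans hb) hi]
    exact (List.getD_eq_default _ _ (hω.trans hi)).symm

theorem BPlusWeight_eq {ω : List ℕ} (hω : ω.length ≤ 5) {m n : ℕ} (hm : 1 ≤ m) (hn : n ≤ 188)
    (h : ∀ t < 188, (List.replicate 4 [2, 1, 1, 1, 0] ++ List.replicate 5 [2, 1, 3, 0, 0] ++
      List.replicate 20 [2, 3, 2, 0, 0] ++ List.replicate 110 [4, 2, 2, 0, 0] ++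
        List.replicate 49 [4, 4, 1, 0, 0]).getD t [] = (List.range 5).map (fun i => ω.getD i 0) ↔
          m ≤ t + 1 ∧ t + 1 ≤ n) :
    BPlusWeight 5 16 ω = a '' Set.Icc m n ∧ (BPlusWeight 5 16 ω).ncard = n + 1 - m := by
  have hsub : Set.Icc m n ⊆ Set.Icc 1 188 := Set.Icc_subset_Icc hm hn
  have key {t : ℕ} (ht : t ∈ Set.Icc 1 188) : weight (a t) = weightVec ω ↔ t ∈ Set.Icc m n := by
    have hb : IsBasis (a t) := (image_a.subset ⟨t, ht, rfl⟩).1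
    have ht1 := ht.1
    have ht2 := ht.2
    have h1 := h (t - 1) (by omega)
    rw [Nat.sub_add_cancel ht1, ← weightList_aList, List.getD_eq_getElem _ _ (by
      rw [List.length_map, length_aList]; omega), List.getElem_map] at h1
    rw [weight_eq_weightVec_iff hb.degree_eq hω, ofFn_a ht, List.getElem_map, h1]
    rfl
  have heq : BPlusWeight 5 16 ω = a '' Set.Icc m n := by
    ext b
    rw [BPlusWeight, BPlus_eq]
    constructor
    · rintro ⟨⟨t, ht, rfl⟩, hw⟩
      exact ⟨t, (key ht).1 hw, rfl⟩
    · rintro ⟨t, ht, rfl⟩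
      exact ⟨⟨t, hsub ht, rfl⟩, (key (hsub ht)).2 ht⟩
  refine ⟨heq, ?_⟩
  rw [heq, (injOn_a.mono hsub).ncard_image, ← Finset.coe_Icc, Set.ncard_coe_finset, Nat.card_Icc]

end HitProblem

end

theorem mainTheorem5 :
    (HitProblem.B 5 16).ncard = 443 ∧
    Module.finrank (ZMod 2) (HitProblem.Q (⊤ : Submodule (ZMod 2) (HitProblem.P 5)) 16) = 443 ∧
    Module.finrank (ZMod 2) (HitProblem.Q (HitProblem.PZero 5) 16) = 255 ∧
    Module.finrank (ZMod 2) (HitProblem.Q (HitProblem.PPlus 5) 16) = 188 ∧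
    (LinearIndepOn (ZMod 2) HitProblem.aClass (Set.Icc 1 188) ∧
      Submodule.span (ZMod 2) (HitProblem.aClass '' Set.Icc 1 188) =
        HitProblem.Q (HitProblem.PPlus 5) 16) ∧
    HitProblem.BPlus 5 16 = HitProblem.a '' Set.Icc 1 188 ∧
    (HitProblem.BPlusWeight 5 16 [2, 1, 1, 1] = HitProblem.a '' Set.Icc 1 4 ∧
      (HitProblem.BPlusWeight 5 16 [2, 1, 1, 1]).ncard = 4) ∧
    (HitProblem.BPlusWeight 5 16 [2, 1, 3] = HitProblem.a '' Set.Icc 5 9 ∧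
      (HitProblem.BPlusWeight 5 16 [2, 1, 3]).ncard = 5) ∧
    (HitProblem.BPlusWeight 5 16 [2, 3, 2] = HitProblem.a '' Set.Icc 10 29 ∧
      (HitProblem.BPlusWeight 5 16 [2, 3, 2]).ncard = 20) ∧
    (HitProblem.BPlusWeight 5 16 [4, 2, 2] = HitProblem.a '' Set.Icc 30 139 ∧
      (HitProblem.BPlusWeight 5 16 [4, 2, 2]).ncard = 110) ∧
    (HitProblem.BPlusWeight 5 16 [4, 4, 1] = HitProblem.a '' Set.Icc 140 188 ∧
      (HitProblem.BPlusWeight 5 16 [4, 4, 1]).ncard = 49) := by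
  have hpos : ∀ b c : Fin 5 →₀ ℕ, HitProblem.supp (List.ofFn b) = HitProblem.supp (List.ofFn c) →
      0 < ∏ j, b j → 0 < ∏ j, c j := by
    intro b c e h
    rw [HitProblem.prod_pos_iff] at h ⊢
    exact e ▸ h
  have htop : (⊤ : Submodule (ZMod 2) (HitProblem.P 5)) = Submodule.span (ZMod 2)
      {f | ∃ b : Fin 5 →₀ ℕ, True ∧ f = HitProblem.mono b} := by
    rw [← (basisMonomials (Fin 5) (ZMod 2)).span_eq]
    congr 1
    ext f
    simp [HitProblem.mono, eq_comm]
  have hclass : HitProblem.aClass =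
      ((HitProblem.hit (HitProblem.PPlus 5)).mkQ ∘ HitProblem.mono) ∘ HitProblem.a := rfl
  refine ⟨?_, ?_, ?_, ?_, ⟨?_, ?_⟩, HitProblem.BPlus_eq, ?_, ?_, ?_, ?_, ?_⟩
  · rw [← HitProblem.ncard_basis.2]
    congr 1
    ext b
    exact HitProblem.mem_B_iff
  · have h := HitProblem.finrank_Q (D := fun _ => True) (fun _ _ _ h => h) htop
    simp only [and_true] at h
    rw [h HitProblem.ncard_basis.1, HitProblem.ncard_basis.2]
  · rw [HitProblem.finrank_Q (M := HitProblem.PZero 5)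
      (D := fun b => ∏ j, b j = 0) (fun b c e h => ?_) rfl
      HitProblem.ncard_zeroBasis.1, HitProblem.ncard_zeroBasis.2]
    by_contra hc
    exact absurd (hpos c b e.symm (Nat.pos_of_ne_zero hc)) (by omega)
  · rw [HitProblem.finrank_Q (M := HitProblem.PPlus 5) (D := fun b => 0 < ∏ j, b j) hpos rfl
      HitProblem.ncard_fullBasis.1, HitProblem.ncard_fullBasis.2]
  · rw [hclass]
    refine LinearIndepOn.comp_of_image ?_ HitProblem.injOn_a
    rw [HitProblem.image_a]
    exact (HitProblem.linearIndepOn_mkQ_mono _).mono fun b hb => hb.1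
  · rw [hclass, Set.image_comp, HitProblem.image_a]
    exact (HitProblem.Q_eq_span (D := fun b => 0 < ∏ j, b j) hpos rfl).symm
  · exact HitProblem.BPlusWeight_eq (by decide) (by decide) (by decide) (by decide +kernel)
  · exact HitProblem.BPlusWeight_eq (by decide) (by decide) (by decide) (by decide +kernel)
  · exact HitProblem.BPlusWeight_eq (by decide) (by decide) (by decide) (by decide +kernel)
  · exact HitProblem.BPlusWeight_eq (by decide) (by decide) (by decide) (by decide +kernel)
  · exact HitProblem.BPlusWeight_eq (by decide) (by decide) (by decide) (by decide +kernel)
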